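/- Consider the fading channel $y=\sqrt{snr}\,h x+n$ with $snr>0$, where the input $x$, the channel gain $h$ and the noise $n$ are independent complex random variables, $n\sim\mathcal{CN}(0,1)$ (independent real and imaginary parts, each $\mathcal N(0,1/2)$), $E|h|^2<\infty$, and $|h|$ has a probability density $f_{|h|}$. The input $x$ is either discrete with finite support, or one of the following continuous inputs: $\infty$-PSK (uniform on the circle $|z|=1$), $\infty$-PAM (uniform on $[-\sqrt3,\sqrt3]$), $\infty$-QAM (uniform on $[-\sqrt{3/2},\sqrt{3/2}]^2\subset\mathbb{C}$), or standard complex Gaussian $\mathcal{CN}(0,1)$. For $h_0\in\mathbb{C}$ let $mmse_{h_0}(snr)=E\big|h_0x-E[h_0x\mid \sqrt{snr}\,h_0x+n]\big|^2$, let $\overline{mmse}(snr)=E_h\{mmse_h(snr)\}$ be the average MMSE, and let $mmse(snr)=mmse_1(snr)=E\big|x-E[x\mid\sqrt{snr}\,x+n]\big|^2$ be the canonical MMSE. For $t>0$ put $$h_1(t)=\tfrac12\sqrt t\,f_{|h|}(\sqrt t),$$ $$\alpha_1=\inf\{a\in\mathbb{R}:h_1(t)=O(t^{-a}),\ t\to0^+\},\qquad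 \beta_1=\sup\{b\in\mathbb{R}:h_1(t)=O(t^{-b}),\ t\to+\infty\}$$ (in $[-\infty,+\infty]$), and let $M[h_1;z]=\int_0^\infty t^{z-1}h_1(t)\,dt$. Let $C_1=(\alpha_1,\beta_1)\cap(-\infty,1)$ if $x$ is discrete and $C_1=(\alpha_1,\beta_1)\cap(0,1)$ if $x$ is continuous. Suppose that 1. $h_1(t)=O(\exp(-k_1t^{v_1}))$ as $t\to+\infty$, for some $k_1\in\mathbb{C}$ with $\mathrm{Re}\,k_1>0$ and some $v_1>0$; 2. $\alpha_1<\beta_1$ and $C_1\neq\emptyset$; 3. there is $c_1\in C_1$ such that, for every real $x\ge c_1$, $M[h_1;x+iy]=O(|y|^{-2})$ as $|y|\to+\infty$, where $M[h_1;\cdot]$ denotes the holomorphic continuation of the Mellin transform from the strip $\alpha_1<\mathrm{Re}\,z<\beta_1$ to the half-plane $\mathrm{Re}\,z>\alpha_1$. Then, for every $snr>0$, the function $h_0\mapsto mmse_{h_0}(snr)$ is integrable with respect to the law of $h$; the integrals $M[h_1;m+1]$, $m=0,1,2,\ldots$, converge absolutely; $mmse$ is infinitely differentiable on $[0,+\infty)$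 (one-sided at $0$); and $$\overline{mmse}(snr)\sim\sum_{m=0}^{+\infty}\frac1{m!}\,M[h_1;m+1]\,mmse^{(m)}(0^+)\,snr^m,\qquad snr\to0^+,$$ that is, for every $m\in\{0,1,2,\ldots\}$, as $snr\to0^+$, $$\overline{mmse}(snr)=\sum_{n=0}^{m}\frac1{n!}M[h_1;n+1]\,mmse^{(n)}(0^+)\,snr^n+O(snr^{m+1}).$$ -/

import Mathlib

open MeasureTheory ProbabilityTheory Filter Asymptotics
open scoped Topology NNReal ENNReal

namespace FadingMMSE

noncomputable section

/-- The standard circularly symmetric complex Gaussian law `CN(0,1)` (unit variance): real and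
imaginary parts are independent real Gaussians with mean `0` and variance `1/2`. -/
def stdComplexGaussian : Measure ℂ :=
  ((gaussianReal 0 (1 / 2)).prod (gaussianReal 0 (1 / 2))).map
    (fun p : ℝ × ℝ => (⟨p.1, p.2⟩ : ℂ))

section Channel

variable {Ω : Type*} [MeasurableSpace Ω]

/-- `mmse_{h₀}(snr)`: the minimum mean-square error in the estimation of the noiseless output
`h₀ x` from the output `y = √snr h₀ x + n`, for the channel gain `h₀`. As the gain is independent
of `(x, n)`, conditioning on `h = h₀` leaves the law of `(x, n)` unchanged. -/
def condMMSE (μ : Measure Ω) (X N : Ω → ℂ) (h₀ : ℂ) (snr : ℝ) : ℝ :=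
  ∫ ω, ‖h₀ * X ω -
    (μ[fun ω' => h₀ * X ω' | MeasurableSpace.comap
      (fun ω' => (Real.sqrt snr : ℂ) * h₀ * X ω' + N ω') inferInstance]) ω‖ ^ 2 ∂μ

/-- The average MMSE `E_h {mmse_h(snr)}`. -/
def avgMMSE (μ : Measure Ω) (X H N : Ω → ℂ) (snr : ℝ) : ℝ :=
  ∫ ω, condMMSE μ X N (H ω) snr ∂μ

/-- The canonical MMSE: the minimum mean-square error in the estimation of `x` from
`y = √snr x + n`. -/
def canonicalMMSE (μ : Measure Ω) (X N : Ω → ℂ) (snr : ℝ) : ℝ :=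
  ∫ ω, ‖X ω - (μ[X | MeasurableSpace.comap
      (fun ω' => (Real.sqrt snr : ℂ) * X ω' + N ω') inferInstance]) ω‖ ^ 2 ∂μ

theorem canonicalMMSE_eq_condMMSE_one (μ : Measure Ω) (X N : Ω → ℂ) (snr : ℝ) :
    canonicalMMSE μ X N snr = condMMSE μ X N 1 snr := by
  simp [canonicalMMSE, condMMSE]

end Channel

/-- The classes of channel inputs: discrete with finite support, `∞`-PSK, `∞`-PAM, `∞`-QAM, and
standard complex Gaussian. -/
inductive InputModel where
  | finiteDiscrete
  | infPSK
  | infPAM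
  | infQAM
  | gaussian

/-- The law `P` of the input conforms to the given model. -/
def InputModel.IsLaw : InputModel → Measure ℂ → Prop
  | .finiteDiscrete, P => ∃ S : Finset ℂ, ∀ᵐ x ∂P, x ∈ S
  | .infPSK, P =>
      P = (volume[| Set.Ioc (0 : ℝ) (2 * Real.pi)]).map
        (fun θ : ℝ => Complex.exp (θ * Complex.I))
  | .infPAM, P =>
      P = (volume[| Set.Icc (-Real.sqrt 3) (Real.sqrt 3)]).map (fun r : ℝ => (r : ℂ))
  | .infQAM, P =>
      P = volume[| Set.Icc (-Real.sqrt (3 / 2)) (Real.sqrt (3 / 2)) ×ℂ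
        Set.Icc (-Real.sqrt (3 / 2)) (Real.sqrt (3 / 2))]
  | .gaussian, P => P = stdComplexGaussian

/-- The interval `]-∞,1[` for discrete inputs and `]0,1[` for continuous inputs. -/
def InputModel.window : InputModel → Set ℝ
  | .finiteDiscrete => Set.Iio 1
  | _ => Set.Ioo 0 1

/-- `h₁(t) = √t f(√t) / 2`, where `f` is the probability density of `|h|`. -/
def fadingFun (f : ℝ → ℝ) (t : ℝ) : ℝ := Real.sqrt t * f (Real.sqrt t) / 2

/-- The infimum (in `[-∞,+∞]`) of the exponents `a` with `g(t) = O(t^{-a})` as `t → 0⁺`. -/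
def lowerExponent (g : ℝ → ℝ) : EReal :=
  sInf ((fun a : ℝ => (a : EReal)) '' {a : ℝ | g =O[𝓝[>] 0] fun t : ℝ => t ^ (-a)})

/-- The supremum (in `[-∞,+∞]`) of the exponents `b` with `g(t) = O(t^{-b})` as `t → +∞`. -/
def upperExponent (g : ℝ → ℝ) : EReal :=
  sSup ((fun b : ℝ => (b : EReal)) '' {b : ℝ | g =O[atTop] fun t : ℝ => t ^ (-b)})

/-- The interval `C₁` of the admissible abscissae. -/
def admissibleAbscissae (model : InputModel) (g : ℝ → ℝ) : Set ℝ :=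
  {c : ℝ | lowerExponent g < (c : EReal) ∧ (c : EReal) < upperExponent g} ∩ model.window

/-- `F` is the analytic continuation of the Mellin transform of `g` from the strip
`lowerExponent g < Re z < upperExponent g` to the half-plane `lowerExponent g < Re z`. -/
def IsMellinContinuation (g : ℝ → ℝ) (F : ℂ → ℂ) : Prop :=
  DifferentiableOn ℂ F {z : ℂ | lowerExponent g < (z.re : EReal)} ∧
  ∀ z : ℂ, lowerExponent g < (z.re : EReal) → (z.re : EReal) < upperExponent g →
    F z = mellin (fun t => (g t : ℂ)) z

/-- The asymptotic expansion `f ∼ ∑ₙ aₙ φₙ` along the filter `l`, for an asymptotic scale `φ`: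
every partial sum up to `n = m` approximates `f` with an error `O(φ_{m+1})`. -/
def HasAsymptoticExpansion (f : ℝ → ℂ) (a : ℕ → ℂ) (φ : ℕ → ℝ → ℂ) (l : Filter ℝ) : Prop :=
  (∀ n, φ (n + 1) =o[l] φ n) ∧
  ∀ m : ℕ, (fun x => f x - ∑ n ∈ Finset.range (m + 1), a n * φ n x) =O[l] φ (m + 1)

end

end FadingMMSE

/-! The average is governed by one scaling identity, `condMMSE_eq_norm_sq_mul_canonicalMMSE`: a gain
`h₀` turns the canonical error into `‖h₀‖² mmse(snr ‖h₀‖²)`. The substitution `t = r²` identifies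
the Mellin value at `m + 1` with the moment `E‖H‖^(2m+2)`. The expansion is thus the Taylor series
of `mmse` at `0`, averaged term by term.

Averaging a Taylor remainder needs two facts. All even moments of the gain must be finite: `E‖H‖²`
is, and the exponential decay of `h₁` supplies the rest (`integrableOn_pow_mul_of_exp_decay`). The
remainder bound must hold on all of `[0,∞)`, since `snr ‖H‖²` need not be small:
`exists_taylor_bound_Ici` obtains it from smoothness near `0` and boundedness of `mmse` by `E‖X‖²`.

The analytic core is smoothness of `mmse` up to `0`. By orthogonality `mmse` is `E‖X‖²` minus
`estimatePower`, an explicit Gaussian integral in the amplitude `a = √snr`. For bounded inputs it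
can be differentiated under the integral to every order, with dominating functions `exp(C(1+‖y‖))`;
rotation invariance makes it even in `a`, and an even smooth function is smooth in `a²`. For the
Gaussian input it equals `a²/(1+a²)`. -/

namespace FadingMMSE

/-! ### The Gaussian noise law: density, isometries, translates -/

/-- The density of the standard complex Gaussian law. -/
noncomputable def complexGaussianPDF (y : ℂ) : ℝ := Real.pi⁻¹ * Real.exp (-‖y‖ ^ 2)

theorem complexGaussianPDF_nonneg (y : ℂ) : 0 ≤ complexGaussianPDF y := by
  unfold complexGaussianPDF; positivity

theorem continuous_complexGaussianPDF : Continuous complexGaussianPDF := by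
  unfold complexGaussianPDF; fun_prop

theorem stdComplexGaussian_eq_withDensity :
    stdComplexGaussian = volume.withDensity (fun y => ENNReal.ofReal (complexGaussianPDF y)) := by
  have hhalf : (1 / 2 : ℝ≥0) ≠ 0 := by norm_num
  have hm : Measurable fun y => ENNReal.ofReal (complexGaussianPDF y) :=
    continuous_complexGaussianPDF.measurable.ennreal_ofReal
  have he := Complex.volume_preserving_equiv_real_prod.symm
  have hfun : (fun p : ℝ × ℝ => (⟨p.1, p.2⟩ : ℂ)) = Complex.measurableEquivRealProd.symm := rfl
  unfold stdComplexGaussian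
  rw [hfun, gaussianReal_of_var_ne_zero 0 hhalf,
    prod_withDensity (measurable_gaussianPDF _ _) (measurable_gaussianPDF _ _)]
  ext s hs
  rw [Measure.map_apply Complex.measurableEquivRealProd.symm.measurable hs,
    withDensity_apply _ (Complex.measurableEquivRealProd.symm.measurable hs),
    withDensity_apply _ hs, ← he.setLIntegral_comp_preimage hs hm]
  refine lintegral_congr fun p => ?_
  rw [gaussianPDF, gaussianPDF, ← ENNReal.ofReal_mul (gaussianPDFReal_nonneg _ _ _)]
  congr 1
  have hn : ‖Complex.measurableEquivRealProd.symm p‖ ^ 2 = p.1 ^ 2 + p.2 ^ 2 := by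
    rw [← Complex.normSq_eq_norm_sq, Complex.normSq_apply]
    simp [Complex.measurableEquivRealProd_symm_apply]
    ring
  have hs2 : (√(2 * Real.pi * ((1 / 2 : ℝ≥0) : ℝ)))⁻¹ * (√(2 * Real.pi * ((1 / 2 : ℝ≥0) : ℝ)))⁻¹
      = Real.pi⁻¹ := by
    rw [← mul_inv, Real.mul_self_sqrt (by positivity)]
    congr 1
    push_cast
    ring
  rw [complexGaussianPDF, hn, gaussianPDFReal, gaussianPDFReal, mul_mul_mul_comm, hs2,
    ← Real.exp_add]
  congr 2
  push_cast
  ring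

instance : IsProbabilityMeasure stdComplexGaussian := by
  unfold stdComplexGaussian
  refine Measure.isProbabilityMeasure_map ?_
  have : (fun p : ℝ × ℝ => (⟨p.1, p.2⟩ : ℂ)) = Complex.measurableEquivRealProd.symm := rfl
  rw [this]
  exact Complex.measurableEquivRealProd.symm.measurable.aemeasurable

theorem integral_stdComplexGaussian {E : Type*} [NormedAddCommGroup E] [NormedSpace ℝ E]
    (g : ℂ → E) :
    ∫ y, g y ∂stdComplexGaussian = ∫ y, complexGaussianPDF y • g y := by
  rw [stdComplexGaussian_eq_withDensity, integral_withDensity_eq_integral_toReal_smul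
    continuous_complexGaussianPDF.measurable.ennreal_ofReal (by simp)]
  simp only [ENNReal.toReal_ofReal (complexGaussianPDF_nonneg _)]

theorem integrable_stdComplexGaussian_iff {E : Type*} [NormedAddCommGroup E] [NormedSpace ℝ E]
    {g : ℂ → E} :
    Integrable g stdComplexGaussian ↔ Integrable (fun y => complexGaussianPDF y • g y) := by
  rw [stdComplexGaussian_eq_withDensity, integrable_withDensity_iff_integrable_smul'
    continuous_complexGaussianPDF.measurable.ennreal_ofReal (by simp)]
  simp only [ENNReal.toReal_ofReal (complexGaussianPDF_nonneg _)]

theorem integral_stdComplexGaussian_comp_isometry {E : Type*} [NormedAddCommGroup E]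
    [NormedSpace ℝ E] (e : ℂ ≃ₗᵢ[ℝ] ℂ) (g : ℂ → E) :
    ∫ y, g (e y) ∂stdComplexGaussian = ∫ y, g y ∂stdComplexGaussian := by
  rw [integral_stdComplexGaussian, integral_stdComplexGaussian,
    ← e.measurePreserving.integral_comp e.toHomeomorph.measurableEmbedding
      (fun y => complexGaussianPDF y • g y)]
  simp [complexGaussianPDF]

/-- The density of the translate by `w` of the standard complex Gaussian law, relative to that
law. -/
noncomputable def likelihood (w y : ℂ) : ℝ := Real.exp (2 * inner ℝ w y - ‖w‖ ^ 2)

theorem likelihood_pos (w y : ℂ) : 0 < likelihood w y := Real.exp_pos _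

theorem continuous_likelihood : Continuous fun p : ℂ × ℂ => likelihood p.1 p.2 := by
  unfold likelihood; fun_prop

/-- The exponent is `‖y‖² - ‖w - y‖²`. Uniformity in `w` makes the likelihood integrable against any
input law. -/
theorem likelihood_le (w y : ℂ) : likelihood w y ≤ Real.exp (‖y‖ ^ 2) := by
  unfold likelihood
  refine Real.exp_le_exp.2 ?_
  have := norm_sub_sq_real w y
  nlinarith [sq_nonneg ‖w - y‖]

theorem complexGaussianPDF_sub (w y : ℂ) :
    complexGaussianPDF (y - w) = complexGaussianPDF y * likelihood w y := by
  have := norm_sub_sq_real y w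
  rw [real_inner_comm] at this
  unfold complexGaussianPDF likelihood
  rw [mul_assoc, ← Real.exp_add, this]
  congr 2
  ring

theorem measurable_ofReal_likelihood (c : ℂ) :
    Measurable fun p : ℂ × ℂ => ENNReal.ofReal (likelihood (c * p.1) p.2) :=
  (continuous_likelihood.comp
    (by fun_prop : Continuous fun p : ℂ × ℂ => (c * p.1, p.2))).measurable.ennreal_ofReal

/-- Translation invariance of Lebesgue measure turns a shift of the noise into a reweighting. Every
output law then has the same reference measure, and the gain appears only in integrands. -/
theorem stdComplexGaussian_preimage_add (w : ℂ) {s : Set ℂ} (hs : MeasurableSet s) :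
    stdComplexGaussian ((fun n => w + n) ⁻¹' s)
      = ∫⁻ y in s, ENNReal.ofReal (likelihood w y) ∂stdComplexGaussian := by
  have hm : Measurable fun y => ENNReal.ofReal (complexGaussianPDF y) :=
    continuous_complexGaussianPDF.measurable.ennreal_ofReal
  have hL : Measurable fun y => ENNReal.ofReal (likelihood w y) :=
    (continuous_likelihood.comp
      (by fun_prop : Continuous fun y : ℂ => (w, y))).measurable.ennreal_ofReal
  have hpre : MeasurableSet ((fun n : ℂ => w + n) ⁻¹' s) := (measurable_const_add w) hs
  rw [stdComplexGaussian_eq_withDensity, withDensity_apply _ hpre,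
    setLIntegral_withDensity_eq_setLIntegral_mul _ hm hL hs, ← lintegral_indicator hpre,
    ← lintegral_indicator hs,
    ← lintegral_add_left_eq_self (μ := volume) (Set.indicator s _) w]
  refine lintegral_congr fun y => ?_
  by_cases h : w + y ∈ s
  · rw [Set.indicator_of_mem (show y ∈ (fun n => w + n) ⁻¹' s from h), Set.indicator_of_mem h,
      Pi.mul_apply, ← ENNReal.ofReal_mul (complexGaussianPDF_nonneg _), ← complexGaussianPDF_sub,
      add_sub_cancel_left]
  · rw [Set.indicator_of_notMem (show y ∉ (fun n => w + n) ⁻¹' s from h),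
      Set.indicator_of_notMem h]

/-! ### Joint law of input and output by change of measure -/

section JointLaw

variable {Ω : Type*} [MeasurableSpace Ω] {μ : Measure Ω} [IsProbabilityMeasure μ] {X N : Ω → ℂ}

theorem map_prodMk_output (hX : Measurable X) (hN : Measurable N) (hXN : X ⟂ᵢ[μ] N)
    (hNlaw : μ.map N = stdComplexGaussian) (c : ℂ) :
    μ.map (fun ω => (X ω, c * X ω + N ω))
      = ((μ.map X).prod stdComplexGaussian).withDensity
        (fun p => ENNReal.ofReal (likelihood (c * p.1) p.2)) := by
  have hL := measurable_ofReal_likelihood c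
  have hprob : IsProbabilityMeasure (μ.map X) := Measure.isProbabilityMeasure_map hX.aemeasurable
  have hT : Measurable fun p : ℂ × ℂ => (p.1, c * p.1 + p.2) := by fun_prop
  have hjoint := (indepFun_iff_map_prod_eq_prod_map_map hX.aemeasurable hN.aemeasurable).1 hXN
  rw [hNlaw] at hjoint
  have hcomp : μ.map (fun ω => (X ω, c * X ω + N ω))
      = ((μ.map X).prod stdComplexGaussian).map (fun p : ℂ × ℂ => (p.1, c * p.1 + p.2)) := by
    rw [← hjoint, Measure.map_map hT (hX.prodMk hN)]
    rfl
  rw [hcomp]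
  ext s hs
  rw [Measure.map_apply hT hs, Measure.prod_apply (hT hs), withDensity_apply _ hs,
    ← lintegral_indicator hs, lintegral_prod _ (hL.indicator hs).aemeasurable]
  refine lintegral_congr fun x => ?_
  have hsx : MeasurableSet (Prod.mk x ⁻¹' s) := measurable_prodMk_left hs
  have := stdComplexGaussian_preimage_add (c * x) hsx
  rw [← lintegral_indicator hsx] at this
  exact this

variable {E : Type*} [NormedAddCommGroup E] [NormedSpace ℝ E]

theorem integrable_comp_output_iff (hX : Measurable X) (hN : Measurable N) (hXN : X ⟂ᵢ[μ] N)
    (hNlaw : μ.map N = stdComplexGaussian) (c : ℂ) {g : ℂ × ℂ → E} (hg : StronglyMeasurable g) :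
    Integrable (fun ω => g (X ω, c * X ω + N ω)) μ ↔
      Integrable (fun p => likelihood (c * p.1) p.2 • g p) ((μ.map X).prod stdComplexGaussian) := by
  have := integrable_map_measure (μ := μ) (f := fun ω => (X ω, c * X ω + N ω)) (g := g)
    hg.aestronglyMeasurable (by fun_prop)
  rw [map_prodMk_output hX hN hXN hNlaw c, integrable_withDensity_iff_integrable_smul'
    (measurable_ofReal_likelihood c) (by simp)] at this
  simp only [ENNReal.toReal_ofReal (likelihood_pos _ _).le] at this
  exact this.symm

theorem integral_comp_output (hX : Measurable X) (hN : Measurable N) (hXN : X ⟂ᵢ[μ] N)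
    (hNlaw : μ.map N = stdComplexGaussian) (c : ℂ) {g : ℂ × ℂ → E} (hg : StronglyMeasurable g)
    (hint : Integrable (fun ω => g (X ω, c * X ω + N ω)) μ) :
    ∫ ω, g (X ω, c * X ω + N ω) ∂μ
      = ∫ y, ∫ x, likelihood (c * x) y • g (x, y) ∂(μ.map X) ∂stdComplexGaussian := by
  have hprob : IsProbabilityMeasure (μ.map X) := Measure.isProbabilityMeasure_map hX.aemeasurable
  have h1 := (integrable_comp_output_iff hX hN hXN hNlaw c hg).1 hint
  have h2 := integral_map (μ := μ) (φ := fun ω => (X ω, c * X ω + N ω)) (by fun_prop)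
    (hg.aestronglyMeasurable)
  rw [← h2, map_prodMk_output hX hN hXN hNlaw c, integral_withDensity_eq_integral_toReal_smul
    (measurable_ofReal_likelihood c) (by simp)]
  simp only [ENNReal.toReal_ofReal (likelihood_pos _ _).le]
  rw [integral_prod_symm _ h1]

end JointLaw

/-! ### Bayes formula for the conditional mean; dependence on the phase of the gain -/

section Estimator

variable (P : Measure ℂ) (c : ℂ)

/-- The density of the output `c x + n` relative to the noise law, for an input `x` of law `P`. -/
noncomputable def outputLikelihood (y : ℂ) : ℝ := ∫ x, likelihood (c * x) y ∂P

/-- The unnormalized conditional mean of the input `x` of law `P` given the output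
`c x + n = y`. -/
noncomputable def weightedInput (y : ℂ) : ℂ := ∫ x, likelihood (c * x) y • x ∂P

/-- The conditional mean of the input given the output. -/
noncomputable def inputEstimate (y : ℂ) : ℂ := (outputLikelihood P c y)⁻¹ • weightedInput P c y

/-- The second moment of the conditional mean of the input given the output `c x + n`. -/
noncomputable def estimatePower : ℝ :=
  ∫ y, ‖weightedInput P c y‖ ^ 2 / outputLikelihood P c y ∂stdComplexGaussian

theorem continuous_likelihood_mul : Continuous fun p : ℂ × ℂ => likelihood (c * p.1) p.2 :=
  continuous_likelihood.comp (by fun_prop : Continuous fun p : ℂ × ℂ => (c * p.1, p.2))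

theorem integrable_likelihood [IsProbabilityMeasure P] (y : ℂ) :
    Integrable (fun x => likelihood (c * x) y) P := by
  refine (integrable_const (Real.exp (‖y‖ ^ 2))).mono' ?_ (ae_of_all _ fun x => ?_)
  · exact ((continuous_likelihood_mul c).comp
      (by fun_prop : Continuous fun x : ℂ => (x, y))).aestronglyMeasurable
  · rw [Real.norm_of_nonneg (likelihood_pos _ _).le]
    exact likelihood_le _ _

theorem outputLikelihood_pos [IsProbabilityMeasure P] (y : ℂ) : 0 < outputLikelihood P c y :=
  integral_exp_pos (integrable_likelihood P c y)

theorem stronglyMeasurable_outputLikelihood [IsProbabilityMeasure P] :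
    StronglyMeasurable (outputLikelihood P c) :=
  (continuous_likelihood_mul c).stronglyMeasurable.integral_prod_left

theorem stronglyMeasurable_weightedInput [IsProbabilityMeasure P] :
    StronglyMeasurable (weightedInput P c) :=
  ((continuous_likelihood_mul c).smul continuous_fst).stronglyMeasurable.integral_prod_left

theorem stronglyMeasurable_inputEstimate [IsProbabilityMeasure P] :
    StronglyMeasurable (inputEstimate P c) :=
  (stronglyMeasurable_outputLikelihood P c).measurable.inv.stronglyMeasurable.smul
    (stronglyMeasurable_weightedInput P c)

theorem outputLikelihood_smul_inputEstimate [IsProbabilityMeasure P] (y : ℂ) :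
    outputLikelihood P c y • inputEstimate P c y = weightedInput P c y :=
  smul_inv_smul₀ (outputLikelihood_pos P c y).ne' _

theorem outputLikelihood_mul_isometry (e : ℂ ≃ₗᵢ[ℝ] ℂ) (y : ℂ) (d : ℂ)
    (h : ∀ x, d * x = e (c * x)) :
    outputLikelihood P d (e y) = outputLikelihood P c y := by
  simp only [outputLikelihood, likelihood, h, e.inner_map_map, e.norm_map]

theorem weightedInput_mul_isometry (e : ℂ ≃ₗᵢ[ℝ] ℂ) (y : ℂ) (d : ℂ)
    (h : ∀ x, d * x = e (c * x)) :
    weightedInput P d (e y) = weightedInput P c y := by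
  simp only [weightedInput, likelihood, h, e.inner_map_map, e.norm_map]

/-- Rotating gain and output together changes neither inner products nor norms, and the noise law is
rotation invariant. -/
theorem estimatePower_rotation (u : Circle) : estimatePower P (u * c) = estimatePower P c := by
  have h : ∀ x, (u * c : ℂ) * x = rotation u (c * x) := fun x => by
    rw [rotation_apply]; ring
  rw [estimatePower, estimatePower, ← integral_stdComplexGaussian_comp_isometry (rotation u)]
  simp only [outputLikelihood_mul_isometry P c (rotation u) _ _ h,
    weightedInput_mul_isometry P c (rotation u) _ _ h]

/-- Used twice: to reduce a complex gain to its modulus, and to get evenness in a real gain. -/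
theorem estimatePower_norm : estimatePower P (‖c‖ : ℂ) = estimatePower P c := by
  rcases eq_or_ne c 0 with rfl | hc
  · simp
  have hn : (‖c‖ : ℂ) ≠ 0 := by simpa using hc
  have hu : ‖c / ‖c‖‖ = 1 := by simp [hc]
  have := estimatePower_rotation P (‖c‖ : ℂ) ⟨c / ‖c‖, mem_sphere_zero_iff_norm.2 hu⟩
  rw [← this]
  simp [div_mul_cancel₀ _ hn]

end Estimator

/-! ### The estimator is the conditional expectation; formula for the MMSE -/

section Channel

variable {Ω : Type*} [MeasurableSpace Ω] {μ : Measure Ω} [IsProbabilityMeasure μ] {X N : Ω → ℂ}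

theorem integrable_weightedInput (hX : Measurable X) (hN : Measurable N) (hXN : X ⟂ᵢ[μ] N)
    (hNlaw : μ.map N = stdComplexGaussian) (hXi : Integrable X μ) (c : ℂ) :
    Integrable (weightedInput (μ.map X) c) stdComplexGaussian := by
  have hprob : IsProbabilityMeasure (μ.map X) := Measure.isProbabilityMeasure_map hX.aemeasurable
  have h := (integrable_comp_output_iff hX hN hXN hNlaw c (g := Prod.fst)
    continuous_fst.stronglyMeasurable).1 hXi
  exact h.integral_prod_right

/-- Integrating out the input first, the likelihood cancels the normalization of the estimate and
leaves `‖weightedInput‖`, already known to be integrable. -/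
theorem integrable_inputEstimate (hX : Measurable X) (hN : Measurable N) (hXN : X ⟂ᵢ[μ] N)
    (hNlaw : μ.map N = stdComplexGaussian) (hXi : Integrable X μ) (c : ℂ) :
    Integrable (fun ω => inputEstimate (μ.map X) c (c * X ω + N ω)) μ := by
  have hprob : IsProbabilityMeasure (μ.map X) := Measure.isProbabilityMeasure_map hX.aemeasurable
  have hsm : StronglyMeasurable fun p : ℂ × ℂ => inputEstimate (μ.map X) c p.2 :=
    (stronglyMeasurable_inputEstimate (μ.map X) c).comp_measurable measurable_snd
  refine (integrable_comp_output_iff hX hN hXN hNlaw c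
    (g := fun p => inputEstimate (μ.map X) c p.2) hsm).2 ?_
  have hLsm : AEStronglyMeasurable
      (fun p : ℂ × ℂ => likelihood (c * p.1) p.2 • inputEstimate (μ.map X) c p.2)
      ((μ.map X).prod stdComplexGaussian) :=
    ((continuous_likelihood_mul c).stronglyMeasurable.smul hsm).aestronglyMeasurable
  rw [integrable_prod_iff' hLsm]
  have hslice : ∀ y, Integrable
      (fun x => likelihood (c * x) y • inputEstimate (μ.map X) c y) (μ.map X) :=
    fun y => (integrable_likelihood _ c y).smul_const _
  refine ⟨Eventually.of_forall hslice, ?_⟩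
  have hnorm : ∀ y, ∫ x, ‖likelihood (c * x) y • inputEstimate (μ.map X) c y‖ ∂(μ.map X)
      = ‖weightedInput (μ.map X) c y‖ := by
    intro y
    simp only [norm_smul, integral_mul_const, Real.norm_of_nonneg (likelihood_pos _ _).le]
    rw [← outputLikelihood_smul_inputEstimate, norm_smul,
      Real.norm_of_nonneg (outputLikelihood_pos _ c y).le, outputLikelihood]
  simp only [hnorm]
  exact (integrable_weightedInput hX hN hXN hNlaw hXi c).norm

theorem integral_mul_input (hX : Measurable X) (hN : Measurable N) (hXN : X ⟂ᵢ[μ] N)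
    (hNlaw : μ.map N = stdComplexGaussian) (c : ℂ) {ψ : ℂ → ℂ} (hψ : StronglyMeasurable ψ)
    (hint : Integrable (fun ω => ψ (c * X ω + N ω) * X ω) μ) :
    ∫ ω, ψ (c * X ω + N ω) * X ω ∂μ
      = ∫ y, ψ y * weightedInput (μ.map X) c y ∂stdComplexGaussian := by
  rw [integral_comp_output hX hN hXN hNlaw c (g := fun p => ψ p.2 * p.1)
    ((hψ.comp_measurable measurable_snd).mul continuous_fst.stronglyMeasurable) hint]
  refine integral_congr_ae (ae_of_all _ fun y => ?_)
  simp only [weightedInput, ← mul_smul_comm, integral_const_mul]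

/-- The right-hand side is that of `integral_mul_input`: the input and its estimate cannot be told
apart by functions of the output. Indicators `ψ` give the conditional expectation, and `ψ` the
conjugate estimate gives orthogonality of the error. -/
theorem integral_mul_inputEstimate (hX : Measurable X) (hN : Measurable N) (hXN : X ⟂ᵢ[μ] N)
    (hNlaw : μ.map N = stdComplexGaussian) (c : ℂ) {ψ : ℂ → ℂ} (hψ : StronglyMeasurable ψ)
    (hint : Integrable (fun ω => ψ (c * X ω + N ω) *
      inputEstimate (μ.map X) c (c * X ω + N ω)) μ) :
    ∫ ω, ψ (c * X ω + N ω) * inputEstimate (μ.map X) c (c * X ω + N ω) ∂μ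
      = ∫ y, ψ y * weightedInput (μ.map X) c y ∂stdComplexGaussian := by
  have hprob : IsProbabilityMeasure (μ.map X) := Measure.isProbabilityMeasure_map hX.aemeasurable
  have hsm : StronglyMeasurable fun p : ℂ × ℂ => inputEstimate (μ.map X) c p.2 :=
    (stronglyMeasurable_inputEstimate (μ.map X) c).comp_measurable measurable_snd
  rw [integral_comp_output hX hN hXN hNlaw c
    (g := fun p => ψ p.2 * inputEstimate (μ.map X) c p.2)
    ((hψ.comp_measurable measurable_snd).mul hsm) hint]
  refine integral_congr_ae (ae_of_all _ fun y => ?_)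
  simp only
  rw [integral_smul_const, ← mul_smul_comm]
  congr 1
  exact outputLikelihood_smul_inputEstimate _ c y

theorem inputEstimate_ae_eq_condExp (hX : Measurable X) (hN : Measurable N) (hXN : X ⟂ᵢ[μ] N)
    (hNlaw : μ.map N = stdComplexGaussian) (hXi : Integrable X μ) (c : ℂ) :
    (fun ω => inputEstimate (μ.map X) c (c * X ω + N ω)) =ᵐ[μ]
      μ[X | MeasurableSpace.comap (fun ω => c * X ω + N ω) inferInstance] := by
  have hprob : IsProbabilityMeasure (μ.map X) := Measure.isProbabilityMeasure_map hX.aemeasurable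
  have hY : Measurable fun ω => c * X ω + N ω := by fun_prop
  have hφi := integrable_inputEstimate hX hN hXN hNlaw hXi c
  refine ae_eq_condExp_of_forall_setIntegral_eq hY.comap_le hXi
    (fun s _ _ => hφi.integrableOn) ?_ ?_
  · rintro _ ⟨s, hs, rfl⟩ -
    have hpre := hY hs
    have hψ : StronglyMeasurable (s.indicator fun _ => (1 : ℂ)) :=
      stronglyMeasurable_const.indicator hs
    have h1 : ∀ Z : Ω → ℂ, (fun ω => s.indicator (fun _ => (1 : ℂ)) (c * X ω + N ω) * Z ω)
        = ((fun ω => c * X ω + N ω) ⁻¹' s).indicator Z := by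
      intro Z
      ext ω
      by_cases h : c * X ω + N ω ∈ s
      · rw [Set.indicator_of_mem h, Set.indicator_of_mem (by exact h), one_mul]
      · rw [Set.indicator_of_notMem h, Set.indicator_of_notMem (by exact h), zero_mul]
    rw [← integral_indicator hpre, ← integral_indicator hpre, ← h1, ← h1,
      integral_mul_input hX hN hXN hNlaw c hψ (by rw [h1]; exact hXi.indicator hpre),
      integral_mul_inputEstimate hX hN hXN hNlaw c hψ (by rw [h1]; exact hφi.indicator hpre)]
  · exact ((stronglyMeasurable_inputEstimate _ c).comp_measurable
      (comap_measurable _)).aestronglyMeasurable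

/-- Pythagoras: with `Z` the estimate, both `E[conj Z · X]` and `E[conj Z · Z]` equal
`estimatePower`, so `E‖X - Z‖² = E‖X‖² - E‖Z‖²`. The gain factors out by linearity of conditional
expectation. -/
theorem condMMSE_eq (hX : Measurable X) (hN : Measurable N) (hXN : X ⟂ᵢ[μ] N)
    (hNlaw : μ.map N = stdComplexGaussian) (hX2 : MemLp X 2 μ) (h₀ : ℂ) (snr : ℝ) :
    condMMSE μ X N h₀ snr = ‖h₀‖ ^ 2 * (∫ ω, ‖X ω‖ ^ 2 ∂μ
      - estimatePower (μ.map X) ((Real.sqrt snr : ℂ) * h₀)) := by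
  have hprob : IsProbabilityMeasure (μ.map X) := Measure.isProbabilityMeasure_map hX.aemeasurable
  set c : ℂ := (Real.sqrt snr : ℂ) * h₀ with hc
  set Z : Ω → ℂ := fun ω => inputEstimate (μ.map X) c (c * X ω + N ω) with hZ
  have hXi : Integrable X μ := hX2.integrable one_le_two
  have hae := inputEstimate_ae_eq_condExp hX hN hXN hNlaw hXi c
  -- Square integrability of the estimate comes from that of conditional expectations, through the
  -- a.e. equality.
  have hZ2 : MemLp Z 2 μ := (memLp_congr_ae hae).2 (hX2.condExp one_le_two)
  have hψ : StronglyMeasurable fun y => (starRingEnd ℂ) (inputEstimate (μ.map X) c y) :=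
    Complex.continuous_conj.comp_stronglyMeasurable (stronglyMeasurable_inputEstimate _ c)
  have hZX : Integrable (fun ω => (starRingEnd ℂ) (Z ω) * X ω) μ :=
    MemLp.integrable_mul hZ2.star hX2
  have hZZ : Integrable (fun ω => (starRingEnd ℂ) (Z ω) * Z ω) μ :=
    MemLp.integrable_mul hZ2.star hZ2
  have e1 := integral_mul_input hX hN hXN hNlaw c hψ hZX
  have e2 := integral_mul_inputEstimate hX hN hXN hNlaw c hψ hZZ
  have e3 : ∫ y, (starRingEnd ℂ) (inputEstimate (μ.map X) c y) * weightedInput (μ.map X) c y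
      ∂stdComplexGaussian = (estimatePower (μ.map X) c : ℂ) := by
    rw [estimatePower, ← integral_complex_ofReal]
    refine integral_congr_ae (ae_of_all _ fun y => ?_)
    simp only [inputEstimate, Complex.real_smul, map_mul, Complex.conj_ofReal, mul_assoc,
      Complex.conj_mul']
    push_cast
    ring
  have hsq : ∀ ω, ‖X ω - Z ω‖ ^ 2 = ‖X ω‖ ^ 2 - 2 * ((starRingEnd ℂ) (Z ω) * X ω).re
      + ((starRingEnd ℂ) (Z ω) * Z ω).re := by
    intro ω
    rw [← Complex.normSq_eq_norm_sq, ← Complex.normSq_eq_norm_sq, Complex.normSq_apply,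
      Complex.normSq_apply]
    simp
    ring
  have hXsq : Integrable (fun ω => ‖X ω‖ ^ 2) μ := hX2.integrable_norm_pow two_ne_zero
  have hmain : ∫ ω, ‖X ω - Z ω‖ ^ 2 ∂μ
      = ∫ ω, ‖X ω‖ ^ 2 ∂μ - estimatePower (μ.map X) c := by
    simp only [hsq]
    have i1 : Integrable (fun ω => 2 * ((starRingEnd ℂ) (Z ω) * X ω).re) μ := hZX.re.const_mul 2
    have i2 : Integrable (fun ω => ((starRingEnd ℂ) (Z ω) * Z ω).re) μ := hZZ.re
    have i3 : Integrable (fun ω => ‖X ω‖ ^ 2 - 2 * ((starRingEnd ℂ) (Z ω) * X ω).re) μ :=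
      hXsq.sub i1
    rw [integral_add i3 i2, integral_sub hXsq i1, integral_const_mul]
    have r1 : ∫ ω, ((starRingEnd ℂ) (Z ω) * X ω).re ∂μ = estimatePower (μ.map X) c := by
      have := integral_re hZX
      simp only [RCLike.re_eq_complex_re] at this
      rw [this, e1, e3, Complex.ofReal_re]
    have r2 : ∫ ω, ((starRingEnd ℂ) (Z ω) * Z ω).re ∂μ = estimatePower (μ.map X) c := by
      have := integral_re hZZ
      simp only [RCLike.re_eq_complex_re] at this
      rw [this, e2, e3, Complex.ofReal_re]
    rw [r1, r2]
    ring
  rw [← hmain, ← integral_const_mul, condMMSE]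
  have hsmul := condExp_smul (μ := μ) h₀ X
    (MeasurableSpace.comap (fun ω => c * X ω + N ω) inferInstance)
  refine integral_congr_ae ?_
  filter_upwards [hae, hsmul] with ω h1 h2
  have h3 : (fun ω' => h₀ * X ω') = h₀ • X := rfl
  rw [h3, h2, Pi.smul_apply, ← h1, smul_eq_mul, ← mul_sub, norm_mul, mul_pow]

end Channel

/-! ### A class of parametric integrands closed under products, inverses, exponentials and
integration -/

section ParametricSmoothness

/-- `Φ a p` is measurable in `p` and bounded by an exponential of the weight `w p`, locally
uniformly in the real parameter `a`. -/
structure HasExpGrowth {W : Type*} [MeasurableSpace W] (w : W → ℝ) (Φ : ℝ → W → ℝ) : Prop where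
  measurable : ∀ a, Measurable (Φ a)
  bound : ∀ K : ℝ, ∃ C : ℝ, 0 ≤ C ∧ ∀ a, |a| ≤ K → ∀ p, |Φ a p| ≤ Real.exp (C * (1 + w p))

/-- `Φ a p` is `n` times differentiable in the real parameter `a`, all derivatives having
exponential growth in the weight `w p`. -/
def ExpSmooth {W : Type*} [MeasurableSpace W] (w : W → ℝ) : ℕ → (ℝ → W → ℝ) → Prop
  | 0, Φ => HasExpGrowth w Φ
  | n + 1, Φ => HasExpGrowth w Φ ∧
      ∃ Φ', (∀ a p, HasDerivAt (fun a => Φ a p) (Φ' a p) a) ∧ ExpSmooth w n Φ'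

variable {W : Type*} [MeasurableSpace W] {w : W → ℝ} {Φ Ψ : ℝ → W → ℝ} {n : ℕ}

theorem HasExpGrowth.mul (hΦ : HasExpGrowth w Φ) (hΨ : HasExpGrowth w Ψ) :
    HasExpGrowth w fun a p => Φ a p * Ψ a p where
  measurable a := (hΦ.measurable a).mul (hΨ.measurable a)
  bound K := by
    obtain ⟨C, hC, h1⟩ := hΦ.bound K
    obtain ⟨D, hD, h2⟩ := hΨ.bound K
    refine ⟨C + D, by positivity, fun a ha p => ?_⟩
    rw [abs_mul, add_mul, Real.exp_add]
    exact mul_le_mul (h1 a ha p) (h2 a ha p) (abs_nonneg _) (Real.exp_pos _).le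

theorem HasExpGrowth.add (hw : ∀ p, 0 ≤ w p) (hΦ : HasExpGrowth w Φ) (hΨ : HasExpGrowth w Ψ) :
    HasExpGrowth w fun a p => Φ a p + Ψ a p where
  measurable a := (hΦ.measurable a).add (hΨ.measurable a)
  bound K := by
    obtain ⟨C, hC, h1⟩ := hΦ.bound K
    obtain ⟨D, hD, h2⟩ := hΨ.bound K
    refine ⟨1 + (C + D), by positivity, fun a ha p => ?_⟩
    have hp := hw p
    have e1 : Real.exp (C * (1 + w p)) ≤ Real.exp ((C + D) * (1 + w p)) :=
      Real.exp_le_exp.2 (by nlinarith [mul_nonneg hD (by linarith : 0 ≤ 1 + w p)])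
    have e2 : Real.exp (D * (1 + w p)) ≤ Real.exp ((C + D) * (1 + w p)) :=
      Real.exp_le_exp.2 (by nlinarith [mul_nonneg hC (by linarith : 0 ≤ 1 + w p)])
    -- The extra `1` in the constant absorbs the factor `2` of the triangle inequality.
    have e3 : 2 ≤ Real.exp (1 * (1 + w p)) := by
      have := Real.add_one_le_exp (1 * (1 + w p))
      linarith
    have e4 := Real.exp_pos ((C + D) * (1 + w p))
    rw [add_mul, Real.exp_add]
    calc |Φ a p + Ψ a p| ≤ |Φ a p| + |Ψ a p| := abs_add_le _ _
      _ ≤ Real.exp ((C + D) * (1 + w p)) + Real.exp ((C + D) * (1 + w p)) :=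
        add_le_add ((h1 a ha p).trans e1) ((h2 a ha p).trans e2)
      _ = 2 * Real.exp ((C + D) * (1 + w p)) := by ring
      _ ≤ _ := mul_le_mul_of_nonneg_right e3 e4.le

theorem ExpSmooth.hasExpGrowth : ∀ {n : ℕ} {Φ : ℝ → W → ℝ}, ExpSmooth w n Φ → HasExpGrowth w Φ
  | 0, _, h => h
  | _ + 1, _, h => h.1

theorem ExpSmooth.of_succ :
    ∀ {n : ℕ} {Φ : ℝ → W → ℝ}, ExpSmooth w (n + 1) Φ → ExpSmooth w n Φ
  | 0, _, h => h.1
  | _ + 1, _, ⟨h, Φ', hd, hs⟩ => ⟨h, Φ', hd, ExpSmooth.of_succ hs⟩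

theorem ExpSmooth.add (hw : ∀ p, 0 ≤ w p) (hΦ : ExpSmooth w n Φ) (hΨ : ExpSmooth w n Ψ) :
    ExpSmooth w n fun a p => Φ a p + Ψ a p := by
  induction n generalizing Φ Ψ with
  | zero => exact HasExpGrowth.add hw hΦ hΨ
  | succ n ih =>
    obtain ⟨Φ', hd, hs⟩ := hΦ.2
    obtain ⟨Ψ', hd', hs'⟩ := hΨ.2
    exact ⟨hΦ.1.add hw hΨ.1, _, fun a p => (hd a p).add (hd' a p), ih hs hs'⟩

theorem ExpSmooth.mul (hw : ∀ p, 0 ≤ w p) (hΦ : ExpSmooth w n Φ) (hΨ : ExpSmooth w n Ψ) :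
    ExpSmooth w n fun a p => Φ a p * Ψ a p := by
  induction n generalizing Φ Ψ with
  | zero => exact HasExpGrowth.mul hΦ hΨ
  | succ n ih =>
    have h1 := hΦ.of_succ
    have h2 := hΨ.of_succ
    obtain ⟨Φ', hd, hs⟩ := hΦ.2
    obtain ⟨Ψ', hd', hs'⟩ := hΨ.2
    exact ⟨hΦ.1.mul hΨ.1, _, fun a p => (hd a p).mul (hd' a p),
      (ih hs h2).add hw (ih h1 hs')⟩

theorem ExpSmooth.of_const (n : ℕ) {q : W → ℝ} (hq : HasExpGrowth w fun _ => q) :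
    ExpSmooth w n fun _ => q := by
  induction n generalizing q with
  | zero => exact hq
  | succ n ih =>
    refine ⟨hq, fun _ _ => 0, fun a p => hasDerivAt_const _ _,
      ih ⟨fun _ => measurable_const, fun K => ⟨0, le_rfl, fun a _ p => ?_⟩⟩⟩
    simp

theorem HasExpGrowth.of_bounded (hw : ∀ p, 0 ≤ w p) (hm : ∀ a, Measurable (Φ a))
    (hb : ∀ K : ℝ, ∃ C : ℝ, ∀ a, |a| ≤ K → ∀ p, |Φ a p| ≤ C) : HasExpGrowth w Φ := by
  refine ⟨hm, fun K => ?_⟩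
  obtain ⟨C, hC⟩ := hb K
  refine ⟨|C|, abs_nonneg _, fun a ha p => (hC a ha p).trans ?_⟩
  have h1 := Real.add_one_le_exp (|C| * (1 + w p))
  nlinarith [le_abs_self C, mul_nonneg (abs_nonneg C) (hw p)]

theorem ExpSmooth.const (hw : ∀ p, 0 ≤ w p) (n : ℕ) (c : ℝ) :
    ExpSmooth w n fun _ _ => c :=
  ExpSmooth.of_const n (HasExpGrowth.of_bounded hw (fun _ => measurable_const)
    fun _ => ⟨|c|, fun _ _ _ => le_rfl⟩)

theorem ExpSmooth.param (hw : ∀ p, 0 ≤ w p) (n : ℕ) : ExpSmooth w n fun a _ => a := by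
  have hg : HasExpGrowth w fun a _ => a :=
    HasExpGrowth.of_bounded hw (fun _ => measurable_const) fun K => ⟨K, fun a ha _ => ha⟩
  cases n with
  | zero => exact hg
  | succ n => exact ⟨hg, fun _ _ => 1, fun a p => hasDerivAt_id a, ExpSmooth.const hw n 1⟩

/-- Growth of the inverse is a hypothesis because upper bounds on `Φ` say nothing of it. Once it is
granted, the derivative `-Φ' Φ⁻²` is a product within the class and induction applies. -/
theorem ExpSmooth.inv (hw : ∀ p, 0 ≤ w p) (hΦ : ExpSmooth w n Φ) (h0 : ∀ a p, Φ a p ≠ 0)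
    (hg : HasExpGrowth w fun a p => (Φ a p)⁻¹) : ExpSmooth w n fun a p => (Φ a p)⁻¹ := by
  induction n with
  | zero => exact hg
  | succ n ih =>
    have h1 := ih hΦ.of_succ
    obtain ⟨Φ', hd, hs⟩ := hΦ.2
    refine ⟨hg, fun a p => -1 * (Φ' a p * ((Φ a p)⁻¹ * (Φ a p)⁻¹)), fun a p => ?_,
      (ExpSmooth.const hw n (-1)).mul hw (hs.mul hw (h1.mul hw h1))⟩
    convert! (hd a p).inv (h0 a p) using 1
    field_simp

theorem ExpSmooth.exp (hw : ∀ p, 0 ≤ w p) (hΦ : ExpSmooth w n Φ)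
    (hg : HasExpGrowth w fun a p => Real.exp (Φ a p)) :
    ExpSmooth w n fun a p => Real.exp (Φ a p) := by
  induction n with
  | zero => exact hg
  | succ n ih =>
    have h1 := ih hΦ.of_succ
    obtain ⟨Φ', hd, hs⟩ := hΦ.2
    exact ⟨hg, _, fun a p => (hd a p).exp, h1.mul hw hs⟩

theorem ExpSmooth.comp {W' : Type*} [MeasurableSpace W'] {f : W' → W} (hf : Measurable f)
    (hΦ : ExpSmooth w n Φ) : ExpSmooth (fun p => w (f p)) n fun a p => Φ a (f p) := by
  have hg : ∀ {Ψ}, HasExpGrowth w Ψ → HasExpGrowth (fun p => w (f p)) fun a p => Ψ a (f p) := by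
    intro Ψ h
    refine ⟨fun a => (h.measurable a).comp hf, fun K => ?_⟩
    obtain ⟨C, hC, hb⟩ := h.bound K
    exact ⟨C, hC, fun a ha p => hb a ha _⟩
  induction n generalizing Φ with
  | zero => exact hg hΦ
  | succ n ih =>
    obtain ⟨Φ', hd, hs⟩ := hΦ.2
    exact ⟨hg hΦ.1, _, fun a p => hd a (f p), ih hs⟩

section Integral

variable {V : Type*} [MeasurableSpace V] {ν : Measure V} {w₁ : V → ℝ}
  {Θ : ℝ → V × W → ℝ}

theorem HasExpGrowth.integrable (hν : ∀ C, Integrable (fun v => Real.exp (C * (1 + w₁ v))) ν)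
    (h : HasExpGrowth (fun p : V × W => w₁ p.1 + w p.2) Θ) (a : ℝ) (q : W) :
    Integrable (fun v => Θ a (v, q)) ν := by
  obtain ⟨C, hC, hb⟩ := h.bound |a|
  refine ((hν C).const_mul (Real.exp (C * w q))).mono'
    ((h.measurable a).comp measurable_prodMk_right).aestronglyMeasurable
    (ae_of_all _ fun v => (hb a le_rfl (v, q)).trans_eq ?_)
  rw [← Real.exp_add]
  congr 1
  ring

theorem HasExpGrowth.integral [SFinite ν] (hw : ∀ p, 0 ≤ w p)
    (hν : ∀ C, Integrable (fun v => Real.exp (C * (1 + w₁ v))) ν)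
    (h : HasExpGrowth (fun p : V × W => w₁ p.1 + w p.2) Θ) :
    HasExpGrowth w fun a q => ∫ v, Θ a (v, q) ∂ν := by
  refine ⟨fun a => ?_, fun K => ?_⟩
  · exact (h.measurable a).stronglyMeasurable.integral_prod_left'.measurable
  · obtain ⟨C, hC, hb⟩ := h.bound K
    set D := ∫ v, Real.exp (C * (1 + w₁ v)) ∂ν with hD
    have hD0 : 0 ≤ D := integral_nonneg fun v => (Real.exp_pos _).le
    refine ⟨C + D, by positivity, fun a ha q => ?_⟩
    have h1 : |∫ v, Θ a (v, q) ∂ν| ≤ ∫ v, Real.exp (C * w q) * Real.exp (C * (1 + w₁ v)) ∂ν := by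
      rw [← Real.norm_eq_abs]
      refine norm_integral_le_of_norm_le ((hν C).const_mul _) (ae_of_all _ fun v => ?_)
      refine (hb a ha (v, q)).trans_eq ?_
      rw [← Real.exp_add]
      congr 1
      ring
    rw [integral_const_mul, ← hD] at h1
    refine h1.trans ?_
    have h2 : D ≤ Real.exp (C + D * (1 + w q)) := by
      have := Real.add_one_le_exp (C + D * (1 + w q))
      nlinarith [mul_nonneg hD0 (hw q)]
    calc Real.exp (C * w q) * D ≤ Real.exp (C * w q) * Real.exp (C + D * (1 + w q)) :=
          mul_le_mul_of_nonneg_left h2 (Real.exp_pos _).le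
      _ = Real.exp ((C + D) * (1 + w q)) := by rw [← Real.exp_add]; congr 1; ring

/-- The weight is additive, so the exponential bound splits into a constant depending on `q` and a
function of `v` integrable by `hν`. This dominates the derivative on the unit ball around `a`,
whence the radius `|a| + 1`. -/
theorem ExpSmooth.integral [SFinite ν] (hw : ∀ p, 0 ≤ w p)
    (hν : ∀ C, Integrable (fun v => Real.exp (C * (1 + w₁ v))) ν)
    (h : ExpSmooth (fun p : V × W => w₁ p.1 + w p.2) n Θ) :
    ExpSmooth w n fun a q => ∫ v, Θ a (v, q) ∂ν := by
  induction n generalizing Θ with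
  | zero => exact HasExpGrowth.integral hw hν h
  | succ n ih =>
    obtain ⟨Θ', hd, hs⟩ := h.2
    refine ⟨h.1.integral hw hν, fun a q => ∫ v, Θ' a (v, q) ∂ν, fun a q => ?_, ih hs⟩
    obtain ⟨C, hC, hb⟩ := hs.hasExpGrowth.bound (|a| + 1)
    refine (hasDerivAt_integral_of_dominated_loc_of_deriv_le
      (F := fun a v => Θ a (v, q)) (F' := fun a v => Θ' a (v, q))
      (bound := fun v => Real.exp (C * w q) * Real.exp (C * (1 + w₁ v)))
      (Metric.ball_mem_nhds a one_pos) (Eventually.of_forall fun b =>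
        (h.1.integrable hν b q).aestronglyMeasurable) (h.1.integrable hν a q)
      (hs.hasExpGrowth.integrable hν a q).aestronglyMeasurable
      (ae_of_all _ fun v b hb' => ?_) ((hν C).const_mul _)
      (ae_of_all _ fun v b _ => hd b (v, q))).2
    have hba : |b| ≤ |a| + 1 := by
      have h1 : |b - a| < 1 := by simpa [Real.dist_eq] using hb'
      have h2 := abs_sub_abs_le_abs_sub b a
      linarith
    refine (hb b hba (v, q)).trans_eq ?_
    rw [← Real.exp_add]
    congr 1
    ring

end Integral

/-- One derivative is spent on continuity of the last one. -/
theorem ExpSmooth.contDiff (h : ExpSmooth w (n + 1) Φ) (p : W) :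
    ContDiff ℝ n fun a => Φ a p := by
  induction n generalizing Φ with
  | zero =>
    obtain ⟨Φ', hd, -⟩ := h.2
    exact contDiff_zero.2 (continuous_iff_continuousAt.2 fun a => (hd a p).continuousAt)
  | succ n ih =>
    obtain ⟨Φ', hd, hs⟩ := h.2
    rw [Nat.cast_succ, contDiff_succ_iff_deriv]
    refine ⟨fun a => (hd a p).differentiableAt, by simp, ?_⟩
    have : deriv (fun a => Φ a p) = fun a => Φ' a p := funext fun a => (hd a p).deriv
    rw [this]
    exact ih hs

theorem contDiff_integral_of_expSmooth {V : Type*} [MeasurableSpace V] {ν : Measure V} [SFinite ν]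
    {w₁ : V → ℝ} (hν : ∀ C, Integrable (fun v => Real.exp (C * (1 + w₁ v))) ν)
    {Θ : ℝ → V → ℝ} (h : ∀ n, ExpSmooth w₁ n Θ) :
    ContDiff ℝ ((⊤ : ℕ∞) : WithTop ℕ∞) fun a => ∫ v, Θ a v ∂ν := by
  refine contDiff_infty.2 fun n => ?_
  -- A one-point factor of weight zero plays the role of the variable left after integration.
  have h1 : ExpSmooth (fun p : V × Unit => w₁ p.1 + (fun _ => 0 : Unit → ℝ) p.2) (n + 1)
      fun a p => Θ a p.1 := by
    simpa using (h (n + 1)).comp (measurable_fst (α := V) (β := Unit))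
  exact (h1.integral (fun _ => le_rfl) hν).contDiff ()

end ParametricSmoothness

/-! ### Even smooth functions as smooth functions of the square -/

section EvenFunctions

theorem expSmooth_comp_mul {W : Type*} [MeasurableSpace W] {w : W → ℝ} (hw : ∀ p, 0 ≤ w p)
    {τ : W → ℝ} (hτ : Measurable τ) (hτ1 : ∀ p, |τ p| ≤ 1) (n : ℕ) {h : ℝ → ℝ}
    (hh : ContDiff ℝ ((⊤ : ℕ∞) : WithTop ℕ∞) h) : ExpSmooth w n fun a p => h (τ p * a) := by
  have hg : ∀ {h : ℝ → ℝ}, ContDiff ℝ ((⊤ : ℕ∞) : WithTop ℕ∞) h →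
      HasExpGrowth w fun a p => h (τ p * a) := by
    intro h hh
    refine HasExpGrowth.of_bounded hw
      (fun a => hh.continuous.measurable.comp (hτ.mul_const a)) fun K => ?_
    obtain ⟨C, hC⟩ := (isCompact_Icc (a := -K) (b := K)).exists_bound_of_continuousOn
      hh.continuous.continuousOn
    refine ⟨C, fun a ha p => hC _ (abs_le.1 ?_)⟩
    rw [abs_mul]
    nlinarith [hτ1 p, abs_nonneg a, abs_nonneg (τ p)]
  induction n generalizing h with
  | zero => exact hg hh
  | succ n ih =>
    have hh' : ContDiff ℝ ((⊤ : ℕ∞) : WithTop ℕ∞) (deriv h) := (contDiff_infty_iff_deriv.1 hh).2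
    refine ⟨hg hh, fun a p => deriv h (τ p * a) * τ p, fun a p => ?_, (ih hh').mul hw
      (ExpSmooth.of_const n (HasExpGrowth.of_bounded hw (fun _ => hτ) fun _ =>
        ⟨1, fun _ _ p => hτ1 p⟩))⟩
    have h1 : HasDerivAt h (deriv h (τ p * a)) (τ p * a) :=
      ((hh.differentiable (by simp)) _).hasDerivAt
    have h2 : HasDerivAt (fun a => τ p * a) (τ p) a := by
      simpa using (hasDerivAt_id a).const_mul (τ p)
    exact h1.comp a h2

/-- Hadamard's lemma: `g'` is odd, hence vanishes at `0`, and `g'(a) = a ∫₀¹ g''(ta) dt`. The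
quotient is again smooth and even, so the construction iterates. -/
theorem exists_deriv_eq_mul_of_even {g : ℝ → ℝ} (hg : ContDiff ℝ ((⊤ : ℕ∞) : WithTop ℕ∞) g)
    (heven : ∀ a, g (-a) = g a) :
    ∃ q : ℝ → ℝ, ContDiff ℝ ((⊤ : ℕ∞) : WithTop ℕ∞) q ∧ (∀ a, q (-a) = q a) ∧
      ∀ a, deriv g a = a * q a := by
  have hg1 : ContDiff ℝ ((⊤ : ℕ∞) : WithTop ℕ∞) (deriv g) := (contDiff_infty_iff_deriv.1 hg).2
  have hg2 : ContDiff ℝ ((⊤ : ℕ∞) : WithTop ℕ∞) (deriv (deriv g)) :=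
    (contDiff_infty_iff_deriv.1 hg1).2
  have hodd : ∀ a, deriv g (-a) = -deriv g a := by
    intro a
    have h := deriv_comp_neg g a
    simp only [heven] at h
    rw [h, neg_neg]
  have heven2 : ∀ a, deriv (deriv g) (-a) = deriv (deriv g) a := by
    intro a
    have h := deriv_comp_neg (deriv g) a
    simp only [hodd] at h
    rw [deriv.fun_neg] at h
    linarith
  have hzero : deriv g 0 = 0 := by
    have := hodd 0
    simp only [neg_zero] at this
    linarith
  -- The integration variable is clamped to `[0,1]`, because growth bounds are required at every
  -- point and not only on the domain of integration.
  set τ : ℝ → ℝ := fun t => max 0 (min t 1) with hτ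
  have hτm : Measurable τ := by fun_prop
  have hτ1 : ∀ t, |τ t| ≤ 1 := fun t => by
    rw [abs_of_nonneg (le_max_left _ _)]
    exact max_le zero_le_one (min_le_right _ _)
  have hsmooth := contDiff_integral_of_expSmooth (ν := volume.restrict (Set.Ioc (0 : ℝ) 1))
    (w₁ := fun _ => 0) (fun C => integrable_const _)
    (fun n => expSmooth_comp_mul (fun _ => le_rfl) hτm hτ1 n hg2)
  refine ⟨_, hsmooth, fun a => ?_, fun a => ?_⟩
  · simp only [mul_neg, heven2]
  · have h1 : ∫ t in Set.Ioc (0 : ℝ) 1, deriv (deriv g) (τ t * a)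
        = ∫ t in (0 : ℝ)..1, deriv (deriv g) (a * t) := by
      rw [intervalIntegral.integral_of_le zero_le_one]
      refine setIntegral_congr_fun measurableSet_Ioc fun t ht => ?_
      simp only [hτ, min_eq_left ht.2, max_eq_right ht.1.le, mul_comm]
    rw [h1, intervalIntegral.mul_integral_comp_mul_left,
      intervalIntegral.integral_deriv_eq_sub
        (fun x _ => (hg1.differentiable (by simp)) x) (hg2.continuous.intervalIntegrable _ _)]
    simp [hzero]

/-- An even smooth function is a smooth function of the square of its variable. -/
theorem contDiffOn_comp_sqrt_of_even {g : ℝ → ℝ} (hg : ContDiff ℝ ((⊤ : ℕ∞) : WithTop ℕ∞) g)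
    (heven : ∀ a, g (-a) = g a) :
    ContDiffOn ℝ ((⊤ : ℕ∞) : WithTop ℕ∞) (fun s => g (Real.sqrt s)) (Set.Ici 0) := by
  refine contDiffOn_infty.2 fun n => ?_
  induction n generalizing g with
  | zero =>
    exact contDiffOn_zero.2 (hg.continuous.comp Real.continuous_sqrt).continuousOn
  | succ n ih =>
    obtain ⟨q, hq, hqe, hgq⟩ := exists_deriv_eq_mul_of_even hg heven
    -- The singular factor `1/(2√s)` of the chain rule cancels against `g'(√s) = √s q(√s)`.
    have hpos : ∀ s : ℝ, 0 < s →
        HasDerivAt (fun s => g (Real.sqrt s)) (q (Real.sqrt s) / 2) s := by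
      intro s hs
      have h1 : HasDerivAt g (deriv g (Real.sqrt s)) (Real.sqrt s) :=
        ((hg.differentiable (by simp)) _).hasDerivAt
      have h2 := h1.comp s (Real.hasDerivAt_sqrt hs.ne')
      rw [hgq] at h2
      convert! h2 using 1
      have := (Real.sqrt_pos.2 hs).ne'
      field_simp
    have hc : Continuous fun s => q (Real.sqrt s) / 2 :=
      (hq.continuous.comp Real.continuous_sqrt).div_const 2
    have hderiv : ∀ s ∈ Set.Ici (0 : ℝ),
        HasDerivWithinAt (fun s => g (Real.sqrt s)) (q (Real.sqrt s) / 2) (Set.Ici 0) s := by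
      intro s hs
      rcases eq_or_lt_of_le (show 0 ≤ s from hs) with rfl | hs
      -- At the endpoint the one-sided derivative is the limit of the derivatives at positive
      -- points.
      · refine hasDerivWithinAt_Ici_of_tendsto_deriv (s := Set.Ioi 0)
          (fun x hx => (hpos x hx).differentiableAt.differentiableWithinAt)
          (hg.continuous.comp Real.continuous_sqrt).continuousWithinAt self_mem_nhdsWithin ?_
        refine ((hc.tendsto 0).mono_left nhdsWithin_le_nhds).congr' ?_
        filter_upwards [self_mem_nhdsWithin] with x hx
        exact (hpos x hx).deriv.symm
      · exact (hpos s hs).hasDerivWithinAt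
    have hu : UniqueDiffOn ℝ (Set.Ici (0 : ℝ)) := uniqueDiffOn_Ici 0
    rw [Nat.cast_succ, contDiffOn_succ_iff_derivWithin hu]
    refine ⟨fun s hs => (hderiv s hs).differentiableWithinAt, by simp, ?_⟩
    exact ((ih hq hqe).div_const 2).congr fun s hs => (hderiv s hs).derivWithin (hu s hs)

end EvenFunctions

/-! ### Smoothness for inputs of bounded support -/

section BoundedInput

theorem integrable_exp_norm_stdComplexGaussian (C : ℝ) :
    Integrable (fun y : ℂ => Real.exp (C * (1 + ‖y‖))) stdComplexGaussian := by
  rw [integrable_stdComplexGaussian_iff]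
  have hG : Integrable fun y : ℂ => Real.exp (-(1 / 2) * ‖y‖ ^ 2) := by
    have := GaussianFourier.integrable_cexp_neg_mul_sq_norm_add (V := ℂ)
      (b := ((1 / 2 : ℝ) : ℂ)) (by simp) 0 0
    refine this.norm.congr (ae_of_all _ fun y => ?_)
    simp only [Complex.norm_exp]
    norm_cast
    simp
  -- The constant comes from `C‖y‖ ≤ ‖y‖²/2 + C²/2`, which costs half of the Gaussian exponent.
  refine (hG.const_mul (Real.pi⁻¹ * Real.exp (C + C ^ 2 / 2))).mono'
    (continuous_complexGaussianPDF.smul (by fun_prop)).aestronglyMeasurable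
    (ae_of_all _ fun y => ?_)
  rw [norm_smul, Real.norm_of_nonneg (complexGaussianPDF_nonneg _),
    Real.norm_of_nonneg (Real.exp_pos _).le, complexGaussianPDF, mul_assoc, mul_assoc,
    ← Real.exp_add, ← Real.exp_add]
  refine mul_le_mul_of_nonneg_left (Real.exp_le_exp.2 ?_) (by positivity)
  nlinarith [sq_nonneg (‖y‖ - C)]

/-- The output weighted by a bounded statistic of a bounded input depends smoothly on the gain. -/
theorem expSmooth_integral_likelihood (P : Measure ℂ) [IsProbabilityMeasure P] {R : ℝ}
    {r : ℂ → ℂ} (hr : Measurable r) (hR : ∀ x, ‖r x‖ ≤ R) {k : ℂ → ℝ} (hk : Measurable k)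
    (hkR : ∀ x, |k x| ≤ R) (n : ℕ) :
    ExpSmooth (fun y : ℂ => ‖y‖) n fun a y => ∫ x, k x * likelihood (a * r x) y ∂P := by
  have hw : ∀ p : ℂ × ℂ, 0 ≤ ‖p.2‖ := fun p => norm_nonneg _
  have hR0 : 0 ≤ R := (norm_nonneg _).trans (hR 0)
  have hfst : Measurable fun p : ℂ × ℂ => r p.1 := hr.comp measurable_fst
  have hinner : HasExpGrowth (fun p : ℂ × ℂ => ‖p.2‖)
      fun _ p => 2 * inner ℝ (r p.1) p.2 := by
    refine ⟨fun _ => (hfst.inner measurable_snd).const_mul 2, fun K =>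
      ⟨2 * R, by positivity, fun a _ p => ?_⟩⟩
    have h1 := abs_real_inner_le_norm (r p.1) p.2
    have h2 := Real.add_one_le_exp (2 * R * (1 + ‖p.2‖))
    have h3 := mul_le_mul_of_nonneg_right (hR p.1) (norm_nonneg p.2)
    rw [abs_mul, abs_two]
    nlinarith
  have hsq : HasExpGrowth (fun p : ℂ × ℂ => ‖p.2‖) fun _ p => -‖r p.1‖ ^ 2 :=
    HasExpGrowth.of_bounded hw (fun _ => (hfst.norm.pow_const 2).neg) fun _ =>
      ⟨R ^ 2, fun _ _ p => by
        rw [abs_neg, abs_of_nonneg (by positivity)]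
        exact pow_le_pow_left₀ (norm_nonneg _) (hR _) 2⟩
  have hexpo : ExpSmooth (fun p : ℂ × ℂ => ‖p.2‖) n
      fun a p => a * (2 * inner ℝ (r p.1) p.2) + a * a * -‖r p.1‖ ^ 2 :=
    ((ExpSmooth.param hw n).mul hw (ExpSmooth.of_const n hinner)).add hw
      (((ExpSmooth.param hw n).mul hw (ExpSmooth.param hw n)).mul hw (ExpSmooth.of_const n hsq))
  have hL : ExpSmooth (fun p : ℂ × ℂ => ‖p.2‖) n
      fun a p => Real.exp (a * (2 * inner ℝ (r p.1) p.2) + a * a * -‖r p.1‖ ^ 2) := by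
    refine hexpo.exp hw ⟨fun a => (hexpo.hasExpGrowth.measurable a).exp, fun K =>
      ⟨2 * |K| * R, by positivity, fun a ha p => ?_⟩⟩
    rw [abs_of_pos (Real.exp_pos _)]
    refine Real.exp_le_exp.2 ?_
    have h1 := abs_real_inner_le_norm (r p.1) p.2
    have h3 := mul_le_mul_of_nonneg_right (hR p.1) (norm_nonneg p.2)
    have h4 : a * inner ℝ (r p.1) p.2 ≤ |K| * (R * ‖p.2‖) := by
      refine (le_abs_self _).trans ?_
      rw [abs_mul]
      exact mul_le_mul (ha.trans (le_abs_self K)) (h1.trans h3) (abs_nonneg _) (abs_nonneg _)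
    have h5 : 0 ≤ a * a * ‖r p.1‖ ^ 2 := mul_nonneg (mul_self_nonneg a) (by positivity)
    have h6 : 0 ≤ |K| * R := by positivity
    nlinarith
  have hkg : HasExpGrowth (fun p : ℂ × ℂ => ‖p.2‖) fun _ p => k p.1 :=
    HasExpGrowth.of_bounded hw (fun _ => hk.comp measurable_fst) fun _ =>
      ⟨R, fun _ _ p => hkR _⟩
  have hprod := (ExpSmooth.of_const n hkg).mul hw hL
  have hprod' : ExpSmooth (fun p : ℂ × ℂ => (fun _ => 0 : ℂ → ℝ) p.1 + ‖p.2‖) n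
      fun a p => k p.1 * Real.exp (a * (2 * inner ℝ (r p.1) p.2) + a * a * -‖r p.1‖ ^ 2) := by
    simpa using hprod
  have hint := hprod'.integral (ν := P) (fun y => norm_nonneg y) (fun C => integrable_const _)
  have hlik : ∀ (a : ℝ) x y, likelihood (a * r x) y
      = Real.exp (a * (2 * inner ℝ (r x) y) + a * a * -‖r x‖ ^ 2) := by
    intro a x y
    rw [likelihood, ← Complex.real_smul, real_inner_smul_left, norm_smul, mul_pow,
      Real.norm_eq_abs, sq_abs]
    congr 1
    ring
  simp only [hlik]
  exact hint

/-- The integrand is `((Re A)² + (Im A)²) B⁻¹`, with `A` and `B` integrals of the likelihood against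
bounded statistics. Only `B⁻¹` needs care: bounded support keeps `B` above a decaying exponential in
`‖y‖`. -/
theorem contDiff_estimatePower_of_bounded (P : Measure ℂ) [IsProbabilityMeasure P] {R : ℝ}
    (hR : ∀ᵐ x ∂P, ‖x‖ ≤ R) :
    ContDiff ℝ ((⊤ : ℕ∞) : WithTop ℕ∞) fun a : ℝ => estimatePower P (a : ℂ) := by
  classical
  have hR0 : 0 ≤ R := by
    obtain ⟨x, hx⟩ := hR.exists
    exact (norm_nonneg x).trans hx
  -- Truncation replaces an almost sure bound by an everywhere bound, without changing any integral
  -- against `P`.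
  set r : ℂ → ℂ := (Metric.closedBall (0 : ℂ) R).indicator id with hr
  have hrm : Measurable r := measurable_id.indicator measurableSet_closedBall
  have hrx : ∀ᵐ x ∂P, r x = x := by
    filter_upwards [hR] with x hx
    exact Set.indicator_of_mem (by simpa using hx) _
  have hrR : ∀ x, ‖r x‖ ≤ R := by
    intro x
    by_cases hx : x ∈ Metric.closedBall (0 : ℂ) R
    · rw [hr, Set.indicator_of_mem hx]; simpa using hx
    · rw [hr, Set.indicator_of_notMem hx]; simpa using hR0
  have hw : ∀ y : ℂ, 0 ≤ ‖y‖ := fun y => norm_nonneg y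
  -- The maximum with `1` lets a single constant also bound the statistic `k = 1`.
  have hrR' : ∀ x, ‖r x‖ ≤ max R 1 := fun x => (hrR x).trans (le_max_left _ _)
  have hB := expSmooth_integral_likelihood P hrm hrR' (k := fun _ => 1) measurable_const
    (fun _ => by simp)
  have hre := expSmooth_integral_likelihood P hrm hrR' (k := fun x => (r x).re)
    (Complex.measurable_re.comp hrm) (fun x => (Complex.abs_re_le_norm _).trans (hrR' x))
  have him := expSmooth_integral_likelihood P hrm hrR' (k := fun x => (r x).im)
    (Complex.measurable_im.comp hrm) (fun x => (Complex.abs_im_le_norm _).trans (hrR' x))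
  have eB : ∀ (a : ℝ) y, ∫ x, 1 * likelihood (a * r x) y ∂P = outputLikelihood P a y := by
    intro a y
    refine integral_congr_ae ?_
    filter_upwards [hrx] with x hx
    rw [hx, one_mul]
  have hA : ∀ (a : ℝ) y, Integrable (fun x => likelihood (a * x) y • x) P := by
    intro a y
    refine ((integrable_likelihood P a y).mul_const R).mono' ?_ ?_
    · exact ((continuous_likelihood_mul a).comp
        (by fun_prop : Continuous fun x : ℂ => (x, y))).smul continuous_id |>.aestronglyMeasurable
    · filter_upwards [hR] with x hx
      rw [norm_smul, Real.norm_of_nonneg (likelihood_pos _ _).le]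
      exact mul_le_mul_of_nonneg_left hx (likelihood_pos _ _).le
  have ere : ∀ (a : ℝ) y, ∫ x, (r x).re * likelihood (a * r x) y ∂P
      = (weightedInput P a y).re := by
    intro a y
    have := integral_re (hA a y)
    simp only [RCLike.re_eq_complex_re] at this
    rw [weightedInput, ← this]
    refine integral_congr_ae ?_
    filter_upwards [hrx] with x hx
    rw [hx, Complex.smul_re, smul_eq_mul, mul_comm]
  have eim : ∀ (a : ℝ) y, ∫ x, (r x).im * likelihood (a * r x) y ∂P
      = (weightedInput P a y).im := by
    intro a y
    have := integral_im (hA a y)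
    simp only [RCLike.im_eq_complex_im] at this
    rw [weightedInput, ← this]
    refine integral_congr_ae ?_
    filter_upwards [hrx] with x hx
    rw [hx, Complex.smul_im, smul_eq_mul, mul_comm]
  simp only [eB] at hB
  simp only [ere] at hre
  simp only [eim] at him
  have hinv : HasExpGrowth (fun y : ℂ => ‖y‖) fun a y => (outputLikelihood P a y)⁻¹ := by
    refine ⟨fun a => ((hB 0).hasExpGrowth.measurable a).inv, fun K =>
      ⟨2 * |K| * R + |K| ^ 2 * R ^ 2, by positivity, fun a ha y => ?_⟩⟩
    have hlow : Real.exp (-((2 * |K| * R + |K| ^ 2 * R ^ 2) * (1 + ‖y‖)))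
        ≤ outputLikelihood P a y := by
      have h0 : ∫ _, Real.exp (-((2 * |K| * R + |K| ^ 2 * R ^ 2) * (1 + ‖y‖))) ∂P
          = Real.exp (-((2 * |K| * R + |K| ^ 2 * R ^ 2) * (1 + ‖y‖))) := by simp
      rw [← h0]
      refine integral_mono_ae (integrable_const _) (integrable_likelihood P a y) ?_
      filter_upwards [hR] with x hx
      refine Real.exp_le_exp.2 ?_
      have h1 := abs_real_inner_le_norm ((a : ℂ) * x) y
      have h2 : ‖(a : ℂ) * x‖ ≤ |K| * R := by
        rw [norm_mul, Complex.norm_real, Real.norm_eq_abs]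
        exact mul_le_mul (ha.trans (le_abs_self K)) hx (norm_nonneg _) (abs_nonneg _)
      have h3 := mul_le_mul_of_nonneg_right h2 (norm_nonneg y)
      have h4 := neg_abs_le (inner ℝ ((a : ℂ) * x) y)
      have h5 : ‖(a : ℂ) * x‖ ^ 2 ≤ (|K| * R) ^ 2 := pow_le_pow_left₀ (norm_nonneg _) h2 2
      have h6 : 0 ≤ |K| * R := by positivity
      have h7 : 0 ≤ (|K| * R) ^ 2 * ‖y‖ := by positivity
      nlinarith
    rw [abs_of_pos (inv_pos.2 (outputLikelihood_pos P a y))]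
    have := inv_anti₀ (Real.exp_pos _) hlow
    rwa [← Real.exp_neg, neg_neg] at this
  have hmain := contDiff_integral_of_expSmooth integrable_exp_norm_stdComplexGaussian fun n =>
    (((hre n).mul hw (hre n)).add hw ((him n).mul hw (him n))).mul hw
      ((hB n).inv hw (fun a y => (outputLikelihood_pos P a y).ne') hinv)
  convert hmain using 2 with a
  refine integral_congr_ae (ae_of_all _ fun y => ?_)
  simp only
  rw [← Complex.normSq_eq_norm_sq, Complex.normSq_apply, div_eq_mul_inv]

theorem contDiffOn_estimatePower_sqrt_of_bounded (P : Measure ℂ) [IsProbabilityMeasure P] {R : ℝ}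
    (hR : ∀ᵐ x ∂P, ‖x‖ ≤ R) :
    ContDiffOn ℝ ((⊤ : ℕ∞) : WithTop ℕ∞) (fun s : ℝ => estimatePower P (Real.sqrt s : ℂ))
      (Set.Ici 0) := by
  refine contDiffOn_comp_sqrt_of_even (contDiff_estimatePower_of_bounded P hR) fun a => ?_
  rw [← estimatePower_norm, ← estimatePower_norm P (a : ℂ)]
  simp

end BoundedInput

/-! ### Closed form for the Gaussian input, whose support is unbounded -/

section GaussianInput

theorem integral_norm_sq_mul_exp_neg {b : ℝ} (hb : 0 < b) :
    ∫ y : ℂ, ‖y‖ ^ 2 * Real.exp (-b * ‖y‖ ^ 2) = Real.pi / b ^ 2 := by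
  have h := Complex.integral_rpow_mul_exp_neg_mul_rpow (p := 2) (q := 2) (b := b)
    (by norm_num) (by norm_num) hb
  have e1 : -((2 : ℝ) + 2) / 2 = -(2 : ℕ) := by norm_num
  have e2 : ((2 : ℝ) + 2) / 2 = 2 := by norm_num
  rw [e1, e2, Real.Gamma_two, Real.rpow_neg hb.le, Real.rpow_natCast] at h
  simp only [Real.rpow_two] at h
  rw [h]
  field_simp

theorem integral_exp_neg_mul_norm_sq {b : ℝ} (hb : 0 < b) :
    ∫ y : ℂ, Real.exp (-b * ‖y‖ ^ 2) = Real.pi / b := by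
  rw [GaussianFourier.integral_rexp_neg_mul_sq_norm hb, Complex.finrank_real_complex]
  norm_num

/-- A Bochner integral is zero by convention when the function is not integrable, so a nonzero value
proves integrability. -/
theorem integrable_exp_neg_mul_norm_sq {b : ℝ} (hb : 0 < b) :
    Integrable fun y : ℂ => Real.exp (-b * ‖y‖ ^ 2) :=
  Integrable.of_integral_ne_zero (by
    rw [integral_exp_neg_mul_norm_sq hb]; exact (div_pos Real.pi_pos hb).ne')

theorem integrable_exp_neg_smul_self {b : ℝ} (hb : 0 < b) :
    Integrable fun y : ℂ => Real.exp (-b * ‖y‖ ^ 2) • y := by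
  have h2 : Integrable fun y : ℂ => ‖y‖ ^ 2 * Real.exp (-b * ‖y‖ ^ 2) :=
    Integrable.of_integral_ne_zero (by
      rw [integral_norm_sq_mul_exp_neg hb]; exact (div_pos Real.pi_pos (by positivity)).ne')
  refine ((integrable_exp_neg_mul_norm_sq hb).add h2).mono'
    (by fun_prop) (ae_of_all _ fun y => ?_)
  rw [norm_smul, Real.norm_of_nonneg (Real.exp_pos _).le, Pi.add_apply]
  nlinarith [Real.exp_pos (-b * ‖y‖ ^ 2), mul_nonneg (Real.exp_pos (-b * ‖y‖ ^ 2)).le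
    (sq_nonneg (‖y‖ - 1))]

theorem integral_exp_neg_smul_self (b : ℝ) :
    ∫ y : ℂ, Real.exp (-b * ‖y‖ ^ 2) • y = 0 := by
  have h := integral_neg_eq_self (fun y : ℂ => Real.exp (-b * ‖y‖ ^ 2) • y) volume
  simp only [norm_neg, smul_neg, integral_neg] at h
  exact self_eq_neg.1 h.symm

theorem integrable_norm_sq_stdComplexGaussian :
    Integrable (fun y : ℂ => ‖y‖ ^ 2) stdComplexGaussian := by
  refine Integrable.of_integral_ne_zero ?_
  have h := integral_norm_sq_mul_exp_neg one_pos
  have e : ∀ y : ℂ, complexGaussianPDF y • ‖y‖ ^ 2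
      = Real.pi⁻¹ * (‖y‖ ^ 2 * Real.exp (-1 * ‖y‖ ^ 2)) := fun y => by
    rw [complexGaussianPDF, smul_eq_mul, neg_one_mul]
    ring
  rw [integral_stdComplexGaussian]
  simp only [e]
  rw [integral_const_mul, h]
  positivity

/-- Completing the square in `x`: given the output `y`, the input is Gaussian with mean `a/(1+a²)
y`. -/
theorem complexGaussianPDF_mul_likelihood (a : ℝ) (x y : ℂ) :
    complexGaussianPDF x * likelihood (a * x) y
      = Real.pi⁻¹ * Real.exp (a ^ 2 / (1 + a ^ 2) * ‖y‖ ^ 2)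
        * Real.exp (-(1 + a ^ 2) * ‖x - (a / (1 + a ^ 2)) • y‖ ^ 2) := by
  have hb : 1 + a ^ 2 ≠ 0 := by positivity
  rw [complexGaussianPDF, likelihood, ← Complex.real_smul, real_inner_smul_left, norm_smul,
    mul_pow, Real.norm_eq_abs, sq_abs, norm_sub_sq_real, real_inner_smul_right, norm_smul,
    mul_pow, Real.norm_eq_abs, sq_abs, mul_assoc, mul_assoc, ← Real.exp_add, ← Real.exp_add]
  congr 2
  field_simp
  ring

theorem outputLikelihood_stdComplexGaussian (a : ℝ) (y : ℂ) :
    outputLikelihood stdComplexGaussian a y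
      = (1 + a ^ 2)⁻¹ * Real.exp (a ^ 2 / (1 + a ^ 2) * ‖y‖ ^ 2) := by
  have hb : 0 < 1 + a ^ 2 := by positivity
  rw [outputLikelihood, integral_stdComplexGaussian]
  simp only [smul_eq_mul, complexGaussianPDF_mul_likelihood]
  rw [integral_const_mul, integral_sub_right_eq_self
    (fun x : ℂ => Real.exp (-(1 + a ^ 2) * ‖x‖ ^ 2)), integral_exp_neg_mul_norm_sq hb]
  field_simp

theorem weightedInput_stdComplexGaussian (a : ℝ) (y : ℂ) :
    weightedInput stdComplexGaussian a y
      = outputLikelihood stdComplexGaussian a y • (a / (1 + a ^ 2)) • y := by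
  have hb : 0 < 1 + a ^ 2 := by positivity
  set m : ℂ := (a / (1 + a ^ 2)) • y with hm
  set k : ℝ := Real.pi⁻¹ * Real.exp (a ^ 2 / (1 + a ^ 2) * ‖y‖ ^ 2) with hk
  have e : ∀ x : ℂ, complexGaussianPDF x • likelihood (a * x) y • x
      = k • (Real.exp (-(1 + a ^ 2) * ‖x - m‖ ^ 2) • (x - m)
        + Real.exp (-(1 + a ^ 2) * ‖x - m‖ ^ 2) • m) := fun x => by
    rw [← smul_add, sub_add_cancel, smul_smul, smul_smul, complexGaussianPDF_mul_likelihood]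
  have h1 : ∫ x : ℂ, complexGaussianPDF x • likelihood (a * x) y • x
      = (k * (Real.pi / (1 + a ^ 2))) • m := by
    simp only [e]
    rw [integral_smul, integral_sub_right_eq_self
      (fun x : ℂ => Real.exp (-(1 + a ^ 2) * ‖x‖ ^ 2) • x
        + Real.exp (-(1 + a ^ 2) * ‖x‖ ^ 2) • m),
      integral_add (integrable_exp_neg_smul_self hb)
        ((integrable_exp_neg_mul_norm_sq hb).smul_const m),
      integral_exp_neg_smul_self, zero_add, integral_smul_const,
      integral_exp_neg_mul_norm_sq hb, smul_smul]
  rw [weightedInput, integral_stdComplexGaussian, h1, outputLikelihood_stdComplexGaussian, hk]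
  congr 1
  field_simp

/-- The estimate is linear in `y`, so the integral is a Gaussian second moment with exponent
coefficient `1 - a²/(1+a²) = (1+a²)⁻¹`. -/
theorem estimatePower_stdComplexGaussian (a : ℝ) :
    estimatePower stdComplexGaussian a = a ^ 2 / (1 + a ^ 2) := by
  have hb : 0 < 1 + a ^ 2 := by positivity
  have hb' : 0 < (1 + a ^ 2)⁻¹ := by positivity
  have e : ∀ y : ℂ, complexGaussianPDF y • (‖weightedInput stdComplexGaussian a y‖ ^ 2
      / outputLikelihood stdComplexGaussian a y)
      = Real.pi⁻¹ * (a ^ 2 / (1 + a ^ 2) ^ 3)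
        * (‖y‖ ^ 2 * Real.exp (-(1 + a ^ 2)⁻¹ * ‖y‖ ^ 2)) := by
    intro y
    have hpos := outputLikelihood_pos stdComplexGaussian a y
    have hexp : Real.exp (-(1 + a ^ 2)⁻¹ * ‖y‖ ^ 2)
        = Real.exp (-‖y‖ ^ 2) * Real.exp (a ^ 2 / (1 + a ^ 2) * ‖y‖ ^ 2) := by
      rw [← Real.exp_add]
      congr 1
      field_simp
      ring
    rw [weightedInput_stdComplexGaussian, norm_smul, norm_smul, Real.norm_of_nonneg hpos.le,
      mul_pow, mul_pow, Real.norm_eq_abs, sq_abs, sq (outputLikelihood _ _ _), mul_assoc,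
      mul_div_cancel_left₀ _ hpos.ne', outputLikelihood_stdComplexGaussian, hexp,
      complexGaussianPDF, smul_eq_mul]
    field_simp
  rw [estimatePower, integral_stdComplexGaussian]
  simp only [e]
  rw [integral_const_mul, integral_norm_sq_mul_exp_neg hb']
  field_simp

theorem contDiffOn_estimatePower_sqrt_stdComplexGaussian :
    ContDiffOn ℝ ((⊤ : ℕ∞) : WithTop ℕ∞)
      (fun s : ℝ => estimatePower stdComplexGaussian (Real.sqrt s : ℂ)) (Set.Ici 0) := by
  have h : ContDiffOn ℝ ((⊤ : ℕ∞) : WithTop ℕ∞) (fun s : ℝ => s / (1 + s)) (Set.Ici 0) :=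
    contDiffOn_id.div (contDiffOn_const.add contDiffOn_id) fun s hs =>
      (by have : 0 ≤ s := hs
          positivity)
  refine h.congr fun s hs => ?_
  rw [estimatePower_stdComplexGaussian, Real.sq_sqrt hs]

end GaussianInput

/-! ### Moments and smoothness for each input model -/

section InputModels

theorem InputModel.IsLaw.exists_bound {model : InputModel} {P : Measure ℂ}
    (h : model.IsLaw P) (hmodel : model ≠ .gaussian) : ∃ R : ℝ, ∀ᵐ x ∂P, ‖x‖ ≤ R := by
  cases model with
  | finiteDiscrete =>
    obtain ⟨S, hS⟩ := h
    refine ⟨∑ z ∈ S, ‖z‖, ?_⟩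
    filter_upwards [hS] with x hx
    exact Finset.single_le_sum (f := fun z : ℂ => ‖z‖) (fun z _ => norm_nonneg z) hx
  | infPSK =>
    refine ⟨1, ?_⟩
    rw [show P = _ from h, ae_map_iff (by fun_prop)
      (measurableSet_le measurable_norm measurable_const)]
    exact ae_of_all _ fun θ => (Complex.norm_exp_ofReal_mul_I θ).le
  | infPAM =>
    refine ⟨Real.sqrt 3, ?_⟩
    rw [show P = _ from h, ae_map_iff (by fun_prop)
      (measurableSet_le measurable_norm measurable_const)]
    filter_upwards [ae_cond_mem measurableSet_Icc] with r hr
    rw [Complex.norm_real, Real.norm_eq_abs]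
    exact abs_le.2 hr
  | infQAM =>
    refine ⟨Real.sqrt (3 / 2) + Real.sqrt (3 / 2), ?_⟩
    rw [show P = _ from h]
    have hm : MeasurableSet (Set.Icc (-Real.sqrt (3 / 2)) (Real.sqrt (3 / 2)) ×ℂ
        Set.Icc (-Real.sqrt (3 / 2)) (Real.sqrt (3 / 2))) :=
      (Complex.measurable_re measurableSet_Icc).inter (Complex.measurable_im measurableSet_Icc)
    filter_upwards [ae_cond_mem hm] with z hz
    exact (Complex.norm_le_abs_re_add_abs_im z).trans
      (add_le_add (abs_le.2 hz.1) (abs_le.2 hz.2))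
  | gaussian => exact absurd rfl hmodel

theorem InputModel.IsLaw.integrable_norm_sq {model : InputModel} {P : Measure ℂ}
    [IsProbabilityMeasure P] (h : model.IsLaw P) : Integrable (fun x => ‖x‖ ^ 2) P := by
  by_cases hmodel : model = .gaussian
  · subst hmodel
    rw [show P = _ from h]
    exact integrable_norm_sq_stdComplexGaussian
  · obtain ⟨R, hR⟩ := h.exists_bound hmodel
    refine (integrable_const (R ^ 2)).mono' (by fun_prop) ?_
    filter_upwards [hR] with x hx
    rw [Real.norm_of_nonneg (by positivity)]
    exact pow_le_pow_left₀ (norm_nonneg _) hx 2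

theorem InputModel.IsLaw.contDiffOn_estimatePower {model : InputModel} {P : Measure ℂ}
    [IsProbabilityMeasure P] (h : model.IsLaw P) :
    ContDiffOn ℝ ((⊤ : ℕ∞) : WithTop ℕ∞) (fun s : ℝ => estimatePower P (Real.sqrt s : ℂ))
      (Set.Ici 0) := by
  by_cases hmodel : model = .gaussian
  · subst hmodel
    rw [show P = _ from h]
    exact contDiffOn_estimatePower_sqrt_stdComplexGaussian
  · obtain ⟨R, hR⟩ := h.exists_bound hmodel
    exact contDiffOn_estimatePower_sqrt_of_bounded P hR

end InputModels

/-! ### A Taylor bound valid on the whole half-line -/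

section Taylor

theorem iteratedDerivWithin_Icc_eq_Ici {f : ℝ → ℝ} (n : ℕ) {b : ℝ} (hb : 0 < b) :
    iteratedDerivWithin n f (Set.Icc 0 b) 0 = iteratedDerivWithin n f (Set.Ici 0) 0 := by
  rw [iteratedDerivWithin_eq_iteratedFDerivWithin, iteratedDerivWithin_eq_iteratedFDerivWithin,
    iteratedFDerivWithin_congr_set]
  filter_upwards [Iio_mem_nhds hb] with x hx
  refine propext ⟨fun h => h.1, fun h => ⟨h, le_of_lt hx⟩⟩

/-- On `[0,1]` this is the usual remainder estimate. For `s ≥ 1` the function is bounded and every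
`s ^ n` with `n ≤ m` is at most `s ^ (m + 1)`, so the crude triangle inequality suffices. -/
theorem exists_taylor_bound_Ici {f : ℝ → ℝ}
    (hf : ContDiffOn ℝ ((⊤ : ℕ∞) : WithTop ℕ∞) f (Set.Ici 0)) {B : ℝ}
    (hB : ∀ s, 0 ≤ s → |f s| ≤ B) (m : ℕ) :
    ∃ C, ∀ s, 0 ≤ s → |f s - ∑ n ∈ Finset.range (m + 1),
      1 / (n.factorial : ℝ) * iteratedDerivWithin n f (Set.Ici 0) 0 * s ^ n| ≤ C * s ^ (m + 1) := by
  set c : ℕ → ℝ := fun n => 1 / (n.factorial : ℝ) * iteratedDerivWithin n f (Set.Ici 0) 0 with hc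
  obtain ⟨C, hC⟩ := exists_taylor_mean_remainder_bound (f := f) (n := m) zero_le_one
    ((hf.of_le (by exact_mod_cast le_top)).mono Set.Icc_subset_Ici_self)
  have hB0 : 0 ≤ B := (abs_nonneg _).trans (hB 0 le_rfl)
  refine ⟨max C (B + ∑ n ∈ Finset.range (m + 1), |c n|), fun s hs => ?_⟩
  rcases le_total s 1 with h1 | h1
  · have h := hC s ⟨hs, h1⟩
    simp only [taylor_within_apply, iteratedDerivWithin_Icc_eq_Ici _ one_pos, sub_zero,
      Real.norm_eq_abs, smul_eq_mul] at h
    refine le_trans (le_of_eq ?_) (h.trans (mul_le_mul_of_nonneg_right (le_max_left _ _)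
      (by positivity)))
    congr 2
    refine Finset.sum_congr rfl fun n _ => ?_
    rw [one_div]
    ring
  · refine le_trans ?_ (mul_le_mul_of_nonneg_right (le_max_right _ _) (by positivity))
    rw [add_mul, Finset.sum_mul]
    refine (abs_sub _ _).trans (add_le_add ?_ ((Finset.abs_sum_le_sum_abs _ _).trans
      (Finset.sum_le_sum fun n hn => ?_)))
    · exact (hB s hs).trans (le_mul_of_one_le_right hB0 (one_le_pow₀ h1))
    · rw [abs_mul, abs_of_nonneg (pow_nonneg hs n)]
      exact mul_le_mul_of_nonneg_left (pow_le_pow_right₀ h1 (Finset.mem_range.1 hn).le)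
        (abs_nonneg _)

end Taylor

/-! ### Mellin values of `h₁` as even moments of the gain -/

section Moments

variable {Ω : Type*} [MeasurableSpace Ω] {μ : Measure Ω} {H : Ω → ℂ}
  {f : ℝ → ℝ}

/-- The law of `‖H‖` does not charge negative reals, so the density vanishes there almost
everywhere; at `0` the positive power vanishes. -/
theorem ae_eq_indicator_density_mul_pow (hH : Measurable H) (hfmeas : Measurable f)
    (hfnonneg : ∀ r, 0 ≤ f r)
    (hfdens : μ.map (fun ω => ‖H ω‖) = volume.withDensity (fun r => ENNReal.ofReal (f r)))
    (m : ℕ) :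
    (fun r => f r * r ^ (2 * m + 2)) =ᵐ[volume]
      (Set.Ioi 0).indicator fun r => f r * r ^ (2 * m + 2) := by
  have h1 : ∀ᵐ r ∂(μ.map fun ω => ‖H ω‖), 0 ≤ r := by
    rw [ae_map_iff hH.norm.aemeasurable measurableSet_Ici]
    exact ae_of_all _ fun ω => norm_nonneg _
  rw [hfdens, ae_withDensity_iff hfmeas.ennreal_ofReal] at h1
  filter_upwards [h1] with r hr
  by_cases h : 0 < r
  · rw [Set.indicator_of_mem (Set.mem_Ioi.2 h)]
  · rw [Set.indicator_of_notMem (by simpa using h)]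
    rcases eq_or_ne r 0 with rfl | h0
    · simp
    · have hlt : r < 0 := lt_of_le_of_ne (not_lt.1 h) h0
      have : ENNReal.ofReal (f r) = 0 := by
        by_contra hne
        exact absurd (hr hne) (not_le.2 hlt)
      rw [le_antisymm (ENNReal.ofReal_eq_zero.1 this) (hfnonneg r), zero_mul]

/-- The substitution `t = r²`: the Jacobian `2r` and the factor `r/2` in `h₁` raise the power by
two. -/
theorem eqOn_fadingFun_comp_sq (m : ℕ) :
    Set.EqOn (fun r : ℝ => (|2| * r ^ ((2 : ℝ) - 1)) •
        ((r ^ (2 : ℝ)) ^ m * fadingFun f (r ^ (2 : ℝ))))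
      (fun r => f r * r ^ (2 * m + 2)) (Set.Ioi 0) := by
  intro r hr
  have h1 : (2 : ℝ) - 1 = 1 := by norm_num
  simp only
  rw [h1, Real.rpow_one, Real.rpow_two, fadingFun, Real.sqrt_sq (le_of_lt hr), abs_two,
    smul_eq_mul, ← pow_mul]
  ring

theorem integrableOn_fadingFun_iff (hH : Measurable H) (hfmeas : Measurable f)
    (hfnonneg : ∀ r, 0 ≤ f r)
    (hfdens : μ.map (fun ω => ‖H ω‖) = volume.withDensity (fun r => ENNReal.ofReal (f r)))
    (m : ℕ) :
    IntegrableOn (fun t => t ^ m * fadingFun f t) (Set.Ioi 0) ↔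
      Integrable (fun ω => ‖H ω‖ ^ (2 * m + 2)) μ := by
  have h1 := integrable_map_measure (μ := μ) (f := fun ω => ‖H ω‖)
    (g := fun r : ℝ => r ^ (2 * m + 2)) (by fun_prop) hH.norm.aemeasurable
  rw [hfdens, integrable_withDensity_iff_integrable_smul' hfmeas.ennreal_ofReal (by simp)] at h1
  simp only [ENNReal.toReal_ofReal (hfnonneg _), smul_eq_mul] at h1
  have h2 : Integrable (fun r => f r * r ^ (2 * m + 2)) ↔
      IntegrableOn (fun r => f r * r ^ (2 * m + 2)) (Set.Ioi 0) := by
    rw [← integrable_indicator_iff measurableSet_Ioi]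
    exact integrable_congr (ae_eq_indicator_density_mul_pow hH hfmeas hfnonneg hfdens m)
  rw [← integrableOn_Ioi_comp_rpow_iff _ (two_ne_zero (α := ℝ)),
    integrableOn_congr_fun (eqOn_fadingFun_comp_sq m) measurableSet_Ioi, ← h2, h1]
  rfl

theorem setIntegral_fadingFun (hH : Measurable H) (hfmeas : Measurable f)
    (hfnonneg : ∀ r, 0 ≤ f r)
    (hfdens : μ.map (fun ω => ‖H ω‖) = volume.withDensity (fun r => ENNReal.ofReal (f r)))
    (m : ℕ) :
    ∫ t in Set.Ioi 0, t ^ m * fadingFun f t = ∫ ω, ‖H ω‖ ^ (2 * m + 2) ∂μ := by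
  have h1 := integral_map (μ := μ) (φ := fun ω => ‖H ω‖) hH.norm.aemeasurable
    (f := fun r : ℝ => r ^ (2 * m + 2)) (by fun_prop)
  rw [hfdens, integral_withDensity_eq_integral_toReal_smul hfmeas.ennreal_ofReal (by simp)] at h1
  simp only [ENNReal.toReal_ofReal (hfnonneg _), smul_eq_mul] at h1
  rw [← integral_comp_rpow_Ioi _ (two_ne_zero (α := ℝ)),
    setIntegral_congr_fun measurableSet_Ioi (eqOn_fadingFun_comp_sq m), ← h1,
    ← integral_indicator measurableSet_Ioi]
  exact (integral_congr_ae (ae_eq_indicator_density_mul_pow hH hfmeas hfnonneg hfdens m)).symm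

/-- Exponential decay at infinity and integrability of a function give all its moments. -/
theorem integrableOn_pow_mul_of_exp_decay {g : ℝ → ℝ} (hg : IntegrableOn g (Set.Ioi 0))
    {k₁ : ℂ} {v₁ : ℝ} (hk₁ : 0 < k₁.re) (hv₁ : 0 < v₁)
    (hdecay : g =O[atTop] fun t : ℝ => Complex.exp (-k₁ * ((t ^ v₁ : ℝ) : ℂ))) (m : ℕ) :
    IntegrableOn (fun t => t ^ m * g t) (Set.Ioi 0) := by
  obtain ⟨C, hC⟩ := hdecay.bound
  obtain ⟨T, hT⟩ := eventually_atTop.1 hC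
  have hexp := (integrableOn_rpow_mul_exp_neg_mul_rpow (s := m) (p := v₁) (b := k₁.re)
    (by have : (0 : ℝ) ≤ m := m.cast_nonneg
        linarith) hv₁ hk₁).const_mul |C|
  -- Below `T` the power is at most `|T| ^ m`; beyond `T` the decay hypothesis applies. The sum of
  -- the two bounds avoids a case split in the dominating function.
  refine (((hg.norm.const_mul (|T| ^ m))).add hexp).mono'
    ((by fun_prop : Continuous fun t : ℝ => t ^ m).aestronglyMeasurable.mul
      hg.aestronglyMeasurable) ?_
  filter_upwards [self_mem_ae_restrict measurableSet_Ioi] with t ht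
  have ht0 : 0 < t := ht
  rw [norm_mul, Real.norm_of_nonneg (by positivity : 0 ≤ t ^ m)]
  simp only [Pi.add_apply, Real.rpow_natCast]
  rcases le_total t T with h | h
  · have h1 : t ^ m ≤ |T| ^ m := pow_le_pow_left₀ ht0.le (h.trans (le_abs_self T)) m
    have h2 := mul_le_mul_of_nonneg_right h1 (norm_nonneg (g t))
    have h3 : 0 ≤ |C| * (t ^ m * Real.exp (-k₁.re * t ^ v₁)) := by positivity
    linarith
  · have h1 := hT t h
    have h4 : (-k₁ * ((t ^ v₁ : ℝ) : ℂ)).re = -k₁.re * t ^ v₁ := by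
      rw [Complex.re_mul_ofReal, Complex.neg_re]
    rw [Complex.norm_exp, h4] at h1
    have h2 : ‖g t‖ ≤ |C| * Real.exp (-k₁.re * t ^ v₁) :=
      h1.trans (mul_le_mul_of_nonneg_right (le_abs_self C) (Real.exp_pos _).le)
    have h3 : 0 ≤ |T| ^ m * ‖g t‖ := by positivity
    have h5 := mul_le_mul_of_nonneg_left h2 (by positivity : 0 ≤ t ^ m)
    linarith

theorem cpow_smul_ofReal (g : ℝ → ℝ) (m : ℕ) (t : ℝ) :
    (t : ℂ) ^ ((m : ℂ) + 1 - 1) • (g t : ℂ) = ((t ^ m * g t : ℝ) : ℂ) := by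
  rw [add_sub_cancel_right, Complex.cpow_natCast, smul_eq_mul]
  push_cast
  rfl

theorem mellinConvergent_natCast_add_one {g : ℝ → ℝ} {m : ℕ}
    (h : IntegrableOn (fun t => t ^ m * g t) (Set.Ioi 0)) :
    MellinConvergent (fun t => (g t : ℂ)) ((m : ℂ) + 1) := by
  unfold MellinConvergent
  simp only [cpow_smul_ofReal]
  exact h.ofReal

theorem mellin_natCast_add_one (g : ℝ → ℝ) (m : ℕ) :
    mellin (fun t => (g t : ℂ)) ((m : ℂ) + 1) = ((∫ t in Set.Ioi 0, t ^ m * g t : ℝ) : ℂ) := by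
  unfold mellin
  simp only [cpow_smul_ofReal]
  exact integral_ofReal

end Moments

/-! ### Scaling and boundedness of the canonical MMSE -/

section Average

variable {Ω : Type*} [MeasurableSpace Ω] {μ : Measure Ω} [IsProbabilityMeasure μ] {X H N : Ω → ℂ}

theorem canonicalMMSE_eq (hX : Measurable X) (hN : Measurable N) (hXN : X ⟂ᵢ[μ] N)
    (hNlaw : μ.map N = stdComplexGaussian) (hX2 : MemLp X 2 μ) (snr : ℝ) :
    canonicalMMSE μ X N snr
      = ∫ ω, ‖X ω‖ ^ 2 ∂μ - estimatePower (μ.map X) (Real.sqrt snr : ℂ) := by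
  rw [canonicalMMSE_eq_condMMSE_one, condMMSE_eq hX hN hXN hNlaw hX2]
  simp

/-- The estimator power sees only the modulus of the effective gain, `√snr ‖h₀‖ = √(snr ‖h₀‖²)`. -/
theorem condMMSE_eq_norm_sq_mul_canonicalMMSE (hX : Measurable X) (hN : Measurable N)
    (hXN : X ⟂ᵢ[μ] N) (hNlaw : μ.map N = stdComplexGaussian) (hX2 : MemLp X 2 μ) (h₀ : ℂ)
    {snr : ℝ} (hsnr : 0 ≤ snr) :
    condMMSE μ X N h₀ snr = ‖h₀‖ ^ 2 * canonicalMMSE μ X N (snr * ‖h₀‖ ^ 2) := by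
  rw [condMMSE_eq hX hN hXN hNlaw hX2, canonicalMMSE_eq hX hN hXN hNlaw hX2,
    ← estimatePower_norm _ ((Real.sqrt snr : ℂ) * h₀), norm_mul, Complex.norm_real,
    Real.norm_of_nonneg (Real.sqrt_nonneg _), Real.sqrt_mul hsnr, Real.sqrt_sq (norm_nonneg _)]

theorem abs_canonicalMMSE_le (hX : Measurable X) (hN : Measurable N) (hXN : X ⟂ᵢ[μ] N)
    (hNlaw : μ.map N = stdComplexGaussian) (hX2 : MemLp X 2 μ) (snr : ℝ) :
    |canonicalMMSE μ X N snr| ≤ ∫ ω, ‖X ω‖ ^ 2 ∂μ := by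
  have hprob : IsProbabilityMeasure (μ.map X) := Measure.isProbabilityMeasure_map hX.aemeasurable
  have h0 : 0 ≤ canonicalMMSE μ X N snr := integral_nonneg fun ω => by positivity
  rw [abs_of_nonneg h0, canonicalMMSE_eq hX hN hXN hNlaw hX2, sub_le_self_iff]
  exact integral_nonneg fun y => div_nonneg (by positivity) (outputLikelihood_pos _ _ _).le

end Average

/-! ### Averaging the Taylor expansion over the gain -/

section Expansion

variable {Ω : Type*} [MeasurableSpace Ω] {μ : Measure Ω} {H : Ω → ℂ}

theorem integrable_norm_sq_mul_comp {M : ℝ → ℝ} (hM : ContinuousOn M (Set.Ici 0)) {B : ℝ}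
    (hB : ∀ s, |M s| ≤ B) (hH : Measurable H) (hH2 : Integrable (fun ω => ‖H ω‖ ^ 2) μ)
    {snr : ℝ} (hsnr : 0 ≤ snr) :
    Integrable (fun ω => ‖H ω‖ ^ 2 * M (snr * ‖H ω‖ ^ 2)) μ := by
  have hc : Continuous fun z : ℂ => M (snr * ‖z‖ ^ 2) :=
    hM.comp_continuous (by fun_prop) fun z => Set.mem_Ici.2 (by positivity)
  refine hH2.mul_bdd (c := B) (hc.measurable.comp hH).aestronglyMeasurable
    (ae_of_all _ fun ω => hB _)

/-- If every even moment of the gain is finite, Taylor expansion commutes with averaging. -/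
theorem abs_integral_sub_taylor_le {M : ℝ → ℝ} (hM : ContinuousOn M (Set.Ici 0)) {B : ℝ}
    (hB : ∀ s, |M s| ≤ B) (hH : Measurable H)
    (hmom : ∀ n : ℕ, Integrable (fun ω => ‖H ω‖ ^ (2 * n + 2)) μ) {c : ℕ → ℝ} {m : ℕ} {C : ℝ}
    (hC : ∀ s, 0 ≤ s → |M s - ∑ n ∈ Finset.range (m + 1), c n * s ^ n| ≤ C * s ^ (m + 1))
    {snr : ℝ} (hsnr : 0 ≤ snr) :
    |∫ ω, ‖H ω‖ ^ 2 * M (snr * ‖H ω‖ ^ 2) ∂μ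
      - ∑ n ∈ Finset.range (m + 1), c n * (∫ ω, ‖H ω‖ ^ (2 * n + 2) ∂μ) * snr ^ n|
      ≤ C * (∫ ω, ‖H ω‖ ^ (2 * (m + 1) + 2) ∂μ) * snr ^ (m + 1) := by
  have hI := integrable_norm_sq_mul_comp hM hB hH (by simpa using hmom 0) hsnr
  have hterm : ∀ n, Integrable (fun ω => c n * snr ^ n * ‖H ω‖ ^ (2 * n + 2)) μ :=
    fun n => (hmom n).const_mul _
  have hsum : ∑ n ∈ Finset.range (m + 1), c n * (∫ ω, ‖H ω‖ ^ (2 * n + 2) ∂μ) * snr ^ n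
      = ∫ ω, ∑ n ∈ Finset.range (m + 1), c n * snr ^ n * ‖H ω‖ ^ (2 * n + 2) ∂μ := by
    rw [integral_finsetSum _ fun n _ => hterm n]
    refine Finset.sum_congr rfl fun n _ => ?_
    rw [integral_const_mul]
    ring
  have hbound : C * (∫ ω, ‖H ω‖ ^ (2 * (m + 1) + 2) ∂μ) * snr ^ (m + 1)
      = ∫ ω, C * snr ^ (m + 1) * ‖H ω‖ ^ (2 * (m + 1) + 2) ∂μ := by
    rw [integral_const_mul]
    ring
  rw [hsum, hbound, ← integral_sub hI (integrable_finsetSum _ fun n _ => hterm n),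
    ← Real.norm_eq_abs]
  refine norm_integral_le_of_norm_le ((hmom (m + 1)).const_mul _) (ae_of_all _ fun ω => ?_)
  -- The Taylor point is random and unbounded in general, hence the need for a bound at every `s ≥
  -- 0`.
  have h := hC (snr * ‖H ω‖ ^ 2) (by positivity)
  have e : ‖H ω‖ ^ 2 * M (snr * ‖H ω‖ ^ 2)
      - ∑ n ∈ Finset.range (m + 1), c n * snr ^ n * ‖H ω‖ ^ (2 * n + 2)
      = ‖H ω‖ ^ 2 * (M (snr * ‖H ω‖ ^ 2)
        - ∑ n ∈ Finset.range (m + 1), c n * (snr * ‖H ω‖ ^ 2) ^ n) := by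
    rw [mul_sub, Finset.mul_sum]
    congr 1
    refine Finset.sum_congr rfl fun n _ => ?_
    ring
  rw [e, norm_mul, Real.norm_of_nonneg (by positivity : 0 ≤ ‖H ω‖ ^ 2), Real.norm_eq_abs]
  refine (mul_le_mul_of_nonneg_left h (by positivity)).trans_eq ?_
  ring

end Expansion

end FadingMMSE

/-! ### Assembly of the expansion -/

theorem mainTheorem7
    {Ω : Type*} [MeasurableSpace Ω] (μ : Measure Ω) [IsProbabilityMeasure μ]
    -- channel input, channel gain and noise: independent complex random variables
    (X H N : Ω → ℂ) (hX : Measurable X) (hH : Measurable H) (hN : Measurable N)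
    (hindep : iIndepFun ![X, H, N] μ)
    (hNlaw : μ.map N = FadingMMSE.stdComplexGaussian)
    (hH2 : Integrable (fun ω => ‖H ω‖ ^ 2) μ)
    (model : FadingMMSE.InputModel) (hXlaw : model.IsLaw (μ.map X))
    -- `f` is a probability density function of `|H|`
    (f : ℝ → ℝ) (hfmeas : Measurable f) (hfnonneg : ∀ r, 0 ≤ f r)
    (hfdens : μ.map (fun ω => ‖H ω‖) = volume.withDensity (fun r => ENNReal.ofReal (f r)))
    -- exponential decay of `h₁`
    (k₁ : ℂ) (v₁ : ℝ) (hk₁ : 0 < k₁.re) (hv₁ : 0 < v₁)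
    (hdecay : FadingMMSE.fadingFun f =O[atTop]
      fun t : ℝ => Complex.exp (-k₁ * ((t ^ v₁ : ℝ) : ℂ)))
    -- conditions on the Mellin transform of `h₁`
    (hstrip : FadingMMSE.lowerExponent (FadingMMSE.fadingFun f)
      < FadingMMSE.upperExponent (FadingMMSE.fadingFun f))
    (hC₁ : (FadingMMSE.admissibleAbscissae model (FadingMMSE.fadingFun f)).Nonempty)
    (F : ℂ → ℂ) (hF : FadingMMSE.IsMellinContinuation (FadingMMSE.fadingFun f) F)
    (hFdecay : ∃ c₁ ∈ FadingMMSE.admissibleAbscissae model (FadingMMSE.fadingFun f),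
      ∀ x : ℝ, c₁ ≤ x →
        (fun y : ℝ => F ((x : ℂ) + (y : ℂ) * Complex.I))
          =O[comap (fun y : ℝ => |y|) atTop] fun y : ℝ => |y| ^ (-2 : ℝ)) :
    -- the quantities in the expansion are well defined
    (∀ snr : ℝ, 0 < snr →
      Integrable (fun ω => FadingMMSE.condMMSE μ X N (H ω) snr) μ) ∧
    (∀ m : ℕ, MellinConvergent (fun t => (FadingMMSE.fadingFun f t : ℂ)) ((m : ℂ) + 1)) ∧
    ContDiffOn ℝ ((⊤ : ℕ∞) : WithTop ℕ∞) (FadingMMSE.canonicalMMSE μ X N) (Set.Ici 0) ∧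
    -- the low-snr expansion
    FadingMMSE.HasAsymptoticExpansion
      (fun snr => (FadingMMSE.avgMMSE μ X H N snr : ℂ))
      (fun m => 1 / (m.factorial : ℂ) *
        mellin (fun t => (FadingMMSE.fadingFun f t : ℂ)) ((m : ℂ) + 1) *
        (iteratedDerivWithin m (FadingMMSE.canonicalMMSE μ X N) (Set.Ici 0) 0 : ℝ))
      (fun m snr => (snr : ℂ) ^ m)
      (𝓝[>] 0) := by
  have hXN : X ⟂ᵢ[μ] N := by
    simpa using hindep.indepFun (show (0 : Fin 3) ≠ 2 by decide)
  have hprob : IsProbabilityMeasure (μ.map X) := Measure.isProbabilityMeasure_map hX.aemeasurable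
  have hX2 : MemLp X 2 μ := by
    refine (memLp_two_iff_integrable_sq_norm hX.aestronglyMeasurable).2 ?_
    exact hXlaw.integrable_norm_sq.comp_measurable hX
  have hMeq := FadingMMSE.canonicalMMSE_eq hX hN hXN hNlaw hX2
  have hMB := FadingMMSE.abs_canonicalMMSE_le hX hN hXN hNlaw hX2
  have hcond := fun (h₀ : ℂ) {snr : ℝ} (h : 0 ≤ snr) =>
    FadingMMSE.condMMSE_eq_norm_sq_mul_canonicalMMSE hX hN hXN hNlaw hX2 h₀ h
  have hsmooth : ContDiffOn ℝ ((⊤ : ℕ∞) : WithTop ℕ∞) (FadingMMSE.canonicalMMSE μ X N)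
      (Set.Ici 0) :=
    (contDiffOn_const.sub hXlaw.contDiffOn_estimatePower).congr fun s _ => hMeq s
  have hg : ∀ m : ℕ, IntegrableOn (fun t => t ^ m * FadingMMSE.fadingFun f t) (Set.Ioi 0) := by
    -- Finiteness of `E‖H‖²` is integrability of `h₁` itself, including near `0`, where the decay
    -- hypothesis gives nothing.
    have h0 := (FadingMMSE.integrableOn_fadingFun_iff hH hfmeas hfnonneg hfdens 0).2
      (by simpa using hH2)
    simp only [pow_zero, one_mul] at h0
    exact FadingMMSE.integrableOn_pow_mul_of_exp_decay h0 hk₁ hv₁ hdecay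
  have hmom : ∀ m : ℕ, Integrable (fun ω => ‖H ω‖ ^ (2 * m + 2)) μ := fun m =>
    (FadingMMSE.integrableOn_fadingFun_iff hH hfmeas hfnonneg hfdens m).1 (hg m)
  refine ⟨fun snr hsnr => ?_, fun m => FadingMMSE.mellinConvergent_natCast_add_one (hg m),
    hsmooth, fun n => ?_, fun m => ?_⟩
  · simp only [hcond _ hsnr.le]
    exact FadingMMSE.integrable_norm_sq_mul_comp hsmooth.continuousOn hMB hH hH2 hsnr.le
  · have h : (fun z : ℂ => z ^ (n + 1)) =o[𝓝 0] fun z => z ^ n := isLittleO_pow_pow n.lt_succ_self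
    refine h.comp_tendsto (k := fun s : ℝ => (s : ℂ)) ?_
    exact (Complex.continuous_ofReal.tendsto' 0 0 Complex.ofReal_zero).mono_left
      nhdsWithin_le_nhds
  · obtain ⟨C, hC⟩ := FadingMMSE.exists_taylor_bound_Ici hsmooth (fun s _ => hMB s) m
    refine IsBigO.of_bound (C * ∫ ω, ‖H ω‖ ^ (2 * (m + 1) + 2) ∂μ) ?_
    filter_upwards [self_mem_nhdsWithin] with snr hsnr
    have hpos : 0 < snr := hsnr
    have h := FadingMMSE.abs_integral_sub_taylor_le hsmooth.continuousOn hMB hH hmom hC hpos.le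
    have havg : FadingMMSE.avgMMSE μ X H N snr
        = ∫ ω, ‖H ω‖ ^ 2 * FadingMMSE.canonicalMMSE μ X N (snr * ‖H ω‖ ^ 2) ∂μ := by
      simp only [FadingMMSE.avgMMSE, hcond _ hpos.le]
    rw [← havg, ← Real.norm_eq_abs, ← Complex.norm_real] at h
    rw [norm_pow, Complex.norm_real, Real.norm_of_nonneg hpos.le]
    refine le_trans (le_of_eq ?_) h
    congr 1
    push_cast
    congr 1
    refine Finset.sum_congr rfl fun n _ => ?_
    rw [FadingMMSE.mellin_natCast_add_one,
      FadingMMSE.setIntegral_fadingFun hH hfmeas hfnonneg hfdens n]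
    ring
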